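/- For a finite set $I$ of qubits let $(\mathbb C^2)^{\otimes I}$ be their state space. Let $|\chi_0\rangle=|0\rangle$ and $|\chi_b\rangle=\tfrac1{\sqrt3}\big(|0\rangle+\sqrt2\,\omega^{b-1}|1\rangle\big)$ for $b=1,2,3$, where $\omega=e^{2\pi i/3}$ (the single-qubit SIC-POVM states). For $C=(c^1,\dots,c^N)$ with $c^t\in\{0,1,2,3\}^n$ put $$|\psi_{c}\rangle=|\chi_{c_1}\rangle\otimes\cdots\otimes|\chi_{c_n}\rangle,\qquad v_C=\frac1{\sqrt N}\sum_{t=1}^N|\psi_{c^t}\rangle,\qquad |\psi_C\rangle=\frac{v_C}{\|v_C\|},\qquad \rho_C=\frac1N\sum_{t=1}^N|\psi_{c^t}\rangle\langle\psi_{c^t}| .$$ An $\ell$-adaptive algorithm using at most $T$ copies of an unknown $n$-qubit state measures the copies one after the other and then accepts or rejects (it may stop early). For each copy it chooses a set $S\subseteq[n]$ with $|S|\le\ell$ and measures the qubits in $[n]\setminus S$ in a product basis $\bigotimes_{i\in[n]\setminus S}\mathcal B_i$ (each $\mathcal B_i$ an orthonormal basis of $\mathbb C^2$) and the qubits in $S$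 in an arbitrary orthonormal basis of $(\mathbb C^2)^{\otimes S}$, which may depend on the outcomes obtained on $[n]\setminus S$. The choices made for a copy may depend on the outcomes for the preceding copies, and the algorithm may be randomized. Its success probability in distinguishing $\sigma$ from $\tau$ is $\tfrac12\big(\Pr[\text{accept}\mid\sigma]+\Pr[\text{reject}\mid\tau]\big)$. **Theorem.** There are constants $c_1,c_2,c_3,c_4,a,b>0$ such that for every $n\ge1$ there is an integer $N$ with $2^{an}\le N\le 2^{bn}$ such that, if $c^1,\dots,c^N$ are drawn independently and uniformly at random from $\{0,1,2,3\}^n$, then with probability at least $4/5$ (so in particular for some choice of $C$) the following holds: $|\psi_C\rangle$ is a unit vector, $\rho_C$ is a density matrix, $\langle\psi_C|\rho_C|\psi_C\rangle\le 2^{-c_1n}$, and, for every integer $\ell$ with $0\le\ell\le c_2n$ and every $T$, every $\ell$-adaptive algorithm using at most $T$ copies whose success probability in distinguishing $|\psi_C\rangle\langle\psi_C|$ from $\rho_C$ is at least $\tfrac12+2^{-c_3n}$ satisfies $T\ge 2^{c_4n}$. -/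

import Mathlib

namespace QCert

open MeasureTheory
open scoped ComplexOrder

/-- The Hilbert space of qubits labelled by `ι`: coordinates are amplitudes of bit strings. -/
abbrev Qubits (ι : Type*) [Fintype ι] := EuclideanSpace ℂ (ι → Fin 2)

/-- Operators on `n` qubits, written in the computational basis. -/
abbrev Op (n : ℕ) := Matrix (Fin n → Fin 2) (Fin n → Fin 2) ℂ

/-- Density matrices, that is, (mixed) states. -/
def IsDensity {n : ℕ} (σ : Op n) : Prop := σ.PosSemidef ∧ σ.trace = 1

/-- The projector `|ψ⟩⟨ψ|`. -/
def proj {n : ℕ} (ψ : Qubits (Fin n)) : Op n := Matrix.vecMulVec ψ (star ψ)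

/-- The number `⟨φ|σ|φ⟩`: the fidelity of `σ` with the pure state `φ`, and also the probability
of the outcome `φ` when `σ` is measured in an orthonormal basis containing `φ`. -/
noncomputable def fidelity {n : ℕ} (φ : Qubits (Fin n)) (σ : Op n) : ℝ :=
  (star (φ : (Fin n → Fin 2) → ℂ) ⬝ᵥ (σ.mulVec φ)).re

/-! ### The states -/

/-- The four single-qubit states of the (tetrahedral) SIC-POVM: `|0⟩` and
`(|0⟩ + √2 ω ^ (b - 1) |1⟩) / √3` for `b = 1, 2, 3`, where `ω = exp (2 π i / 3)`. -/
noncomputable def sic (b : Fin 4) : EuclideanSpace ℂ (Fin 2) :=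
  if b = 0 then !₂[1, 0]
  else !₂[1 / (Real.sqrt 3 : ℂ),
    (Real.sqrt 2 : ℂ) / (Real.sqrt 3 : ℂ) *
      Complex.exp (2 * Real.pi * Complex.I / 3) ^ ((b : ℕ) - 1)]

/-- The product state `χ_{c 1} ⊗ ⋯ ⊗ χ_{c n}`. -/
noncomputable def sicProduct {n : ℕ} (c : Fin n → Fin 4) : Qubits (Fin n) :=
  WithLp.toLp 2 fun w => ∏ i, sic (c i) (w i)

/-- The superposition `N ^ (-1/2) ∑ t, |ψ_{c^t}⟩`. -/
noncomputable def superposition {n N : ℕ} (C : Fin N → Fin n → Fin 4) : Qubits (Fin n) :=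
  (1 / (Real.sqrt N : ℂ)) • ∑ t, sicProduct (C t)

/-- The pure state in the direction of the superposition. -/
noncomputable def pureState {n N : ℕ} (C : Fin N → Fin n → Fin 4) : Qubits (Fin n) :=
  ((‖superposition C‖⁻¹ : ℝ) : ℂ) • superposition C

/-- The uniform mixture `N⁻¹ ∑ t, |ψ_{c^t}⟩⟨ψ_{c^t}|`. -/
noncomputable def mixedState {n N : ℕ} (C : Fin N → Fin n → Fin 4) : Op n :=
  (1 / (N : ℂ)) • ∑ t, proj (sicProduct (C t))

/-! ### The algorithms -/

/-- How one copy of an `n`-qubit state is measured with at most `ℓ` adaptive qubits: the qubits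
outside `S` are measured in a fixed product basis, and the qubits in `S` in an arbitrary
orthonormal basis of their joint space, which may depend on the outcomes outside `S`. -/
structure AdaptiveBasis (n ℓ : ℕ) where
  S : Finset (Fin n)
  card_le : S.card ≤ ℓ
  fixedPart : {i // i ∉ S} → OrthonormalBasis (Fin 2) ℂ (EuclideanSpace ℂ (Fin 2))
  adaptivePart : ({i // i ∉ S} → Fin 2) →
    OrthonormalBasis ({i // i ∈ S} → Fin 2) ℂ (Qubits {i // i ∈ S})

/-- The basis vector that belongs to the outcome `x`. -/
noncomputable def AdaptiveBasis.vec {n ℓ : ℕ} (M : AdaptiveBasis n ℓ) (x : Fin n → Fin 2) :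
    Qubits (Fin n) :=
  WithLp.toLp 2 fun w =>
    (∏ i : {i // i ∉ M.S}, M.fixedPart i (x i) (w i)) *
      M.adaptivePart (fun i => x i) (fun i => x i) (fun i => w i)

/-- A deterministic `ℓ`-adaptive algorithm that uses at most `T` copies: it either stops with a
verdict (`true` is "accept"), or measures one more copy and goes on depending on the outcome. -/
inductive Strategy (n ℓ : ℕ) : ℕ → Type
  | output {T : ℕ} (verdict : Bool) : Strategy n ℓ T
  | measure {T : ℕ} (M : AdaptiveBasis n ℓ) (next : (Fin n → Fin 2) → Strategy n ℓ T) :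
      Strategy n ℓ (T + 1)

/-- The probability that the algorithm accepts when all copies are in the state `σ`. -/
noncomputable def Strategy.acceptProb {n ℓ : ℕ} (σ : Op n) :
    {T : ℕ} → Strategy n ℓ T → ℝ
  | _, .output verdict => if verdict then 1 else 0
  | _, .measure M next => ∑ x, fidelity (M.vec x) σ * (next x).acceptProb σ

/-- A randomized `ℓ`-adaptive algorithm that uses at most `T` copies: a deterministic one, chosen
with the help of a random seed. -/
structure Algorithm (n ℓ T : ℕ) where
  Seed : Type
  [measurableSpace : MeasurableSpace Seed]
  law : Measure Seed
  [isProbabilityMeasure : IsProbabilityMeasure law]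
  strategy : Seed → Strategy n ℓ T
  measurable_acceptProb : ∀ σ : Op n, IsDensity σ →
    Measurable fun r => (strategy r).acceptProb σ

/-- The probability that the randomized algorithm accepts when all copies are in state `σ`. -/
noncomputable def Algorithm.acceptProb {n ℓ T : ℕ} (A : Algorithm n ℓ T) (σ : Op n) : ℝ :=
  letI := A.measurableSpace
  ∫ r, (A.strategy r).acceptProb σ ∂A.law

/-- The probability of a correct verdict when the state is `σ` (to be accepted) or `τ` (to be
rejected), each with probability `1 / 2`. -/
noncomputable def Algorithm.successProb {n ℓ T : ℕ} (A : Algorithm n ℓ T) (σ τ : Op n) : ℝ :=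
  (A.acceptProb σ + (1 - A.acceptProb τ)) / 2

end QCert

/-!
The two states are hard to tell apart because, in every allowed measurement basis, the terms
`a t x = ⟨x|ψ_{c t}⟩` of the superposition hardly interfere. The outcome distributions of
`superposition C` and `mixedState C` differ in `L¹` by at most
`N⁻¹ ∑_{s ≠ t} ∑_x |a s x| |a t x|` (`sum_abs_fidelity_sub_le`, which also absorbs the
normalization), and a hybrid argument over the copies (`Strategy.acceptProb_sub_le`) turns this into
a bound on the success probability that is linear in the number of copies.

For a fixed pair of words, the adaptive qubits contribute at most `1` to `∑_x |a s x| |a t x|` by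
Cauchy–Schwarz, and every other qubit contributes the Bhattacharyya coefficient of two outcome
distributions in a single-qubit basis (`AdaptiveBasis.sum_norm_inner_mul_le_prod_overlap`). The SIC
states form a 2-design, so in any basis the four probabilities of an outcome have variance `1 / 12`;
hence for every letter `a` some letter `b` is told apart from it, with Bhattacharyya coefficient at
most `√(11 / 12)` (`isSeparating_distinguishes`, `overlap_le_of_distinguishes`). The only feature of
a basis that matters is thus the relation "told apart" on four letters, so a union bound over
`2 ^ (16 n)` families of relations replaces a union bound over a continuum of bases.

For a fixed family, two random words are close, that is, told apart at no more than `n / 16`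
coordinates, with probability at most `2 ^ (n / 16) (7 / 8) ^ n`. Ordering the words, let `U` be the
number of words that are close to a later one. Prepending words one at a time bounds the moment
`E[z ^ U]` for an exponentially large `z`, so `U ≥ 289` has probability at most `3 * 2 ^ (-17 n)`
(`card_many_earlyHits_le`). The same holds in the reversed order, and a close pair starts in one of
the two exceptional sets and ends in the other, so at most `2 * 288 ^ 2` ordered pairs are close
(`card_bad_pairs_le`, `card_not_isSparse_le`). With `N = 2 ^ (n / 1024)` words, the boundedly many
close pairs and the exponentially small contribution of all the others give an interference term
that is exponentially small in `n`. The bound on the fidelity is the Frobenius norm of the Gram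
matrix (`sq_fidelity_mixedState_le`), estimated by sparsity for the relation `≠`.

For `n < 65536` the constants are so small that the required success probability is at least `1`,
which is never attained because `mixedState C` dominates a positive multiple of the pure state
(`successProb_lt_one`); there `N = 4`, and the fidelity is bounded unless all words coincide.
-/

namespace QCert

/-! ### Sparsity of a rare relation along a random sequence -/

open scoped Classical in
/-- The positions of a sequence that are related to some later position. -/
noncomputable def earlyHits {X : Type*} (bad : X → X → Prop) {N : ℕ} (C : Fin N → X) :
    Finset (Fin N) :=
  {s | ∃ t, s < t ∧ bad (C s) (C t)}

open scoped Classical in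
theorem card_earlyHits_cons {X : Type*} (bad : X → X → Prop) {N : ℕ} (x : X) (C : Fin N → X) :
    (earlyHits bad (Fin.cons x C : Fin (N + 1) → X)).card =
      (if ∃ t, bad x (C t) then 1 else 0) + (earlyHits bad C).card := by
  unfold earlyHits
  have h0 : (∃ t, (0 : Fin (N + 1)) < t ∧
      bad ((Fin.cons x C : Fin (N + 1) → X) 0) ((Fin.cons x C : Fin (N + 1) → X) t)) ↔
      ∃ t, bad x (C t) := by
    simp [Fin.exists_fin_succ]
  have h1 : ∀ s : Fin N, (∃ t, s.succ < t ∧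
      bad ((Fin.cons x C : Fin (N + 1) → X) s.succ) ((Fin.cons x C : Fin (N + 1) → X) t)) ↔
      ∃ t, s < t ∧ bad (C s) (C t) := by
    intro s
    simp [Fin.exists_fin_succ]
  rw [Fin.card_filter_univ_succ]
  simp only [h0, h1]
  split_ifs <;> ring

/-- Exponential moment of the number of early hits: prepending one element creates a new hit with
probability at most `N * p`. -/
theorem sum_pow_card_earlyHits_le {X : Type*} [Fintype X] (bad : X → X → Prop)
    (hsymm : ∀ x y, bad x y → bad y x) {p z : ℝ} (hp : 0 ≤ p) (hz : 1 ≤ z)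
    (hbad : ∀ x, (Nat.card {y // bad x y} : ℝ) ≤ p * Fintype.card X) (N : ℕ) :
    ∑ C : Fin N → X, z ^ (earlyHits bad C).card ≤
      ((Fintype.card X : ℝ) * (1 + z * (N * p))) ^ N := by
  classical
  suffices h : ∀ K : ℕ, N ≤ K → ∑ C : Fin N → X, z ^ (earlyHits bad C).card ≤
      ((Fintype.card X : ℝ) * (1 + z * (K * p))) ^ N from h N le_rfl
  intro K
  induction N with
  | zero => intro _; simp [earlyHits]
  | succ N ih =>
    intro hK
    have hz0 : 0 ≤ z := by linarith
    rw [← (Fin.consEquiv fun _ => X).sum_comp, Fintype.sum_prod_type, Finset.sum_comm, pow_succ]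
    have step : ∀ C : Fin N → X,
        ∑ x, z ^ (earlyHits bad ((Fin.consEquiv fun _ => X) (x, C))).card ≤
        z ^ (earlyHits bad C).card * ((Fintype.card X : ℝ) * (1 + z * (K * p))) := by
      intro C
      have e1 : ∀ x, z ^ (earlyHits bad ((Fin.consEquiv fun _ => X) (x, C))).card ≤
          z ^ (earlyHits bad C).card * (1 + z * ∑ t, if bad (C t) x then 1 else 0) := by
        intro x
        have : (Fin.consEquiv fun _ => X) (x, C) = (Fin.cons x C : Fin (N + 1) → X) := rfl
        rw [this, card_earlyHits_cons, pow_add, mul_comm]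
        refine mul_le_mul_of_nonneg_left ?_ (by positivity)
        have hnn : (0 : ℝ) ≤ ∑ t, if bad (C t) x then (1 : ℝ) else 0 :=
          Finset.sum_nonneg fun t _ => by split_ifs <;> norm_num
        split_ifs with h
        · obtain ⟨t, ht⟩ := h
          have : (1 : ℝ) ≤ ∑ t, if bad (C t) x then (1 : ℝ) else 0 := by
            refine le_trans ?_ (Finset.single_le_sum (f := fun t => if bad (C t) x then (1 : ℝ)
              else 0) (fun t _ => by split_ifs <;> norm_num) (Finset.mem_univ t))
            simp [hsymm _ _ ht]
          nlinarith
        · nlinarith [mul_nonneg hz0 hnn]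
      refine (Finset.sum_le_sum fun x _ => e1 x).trans ?_
      rw [← Finset.mul_sum]
      refine mul_le_mul_of_nonneg_left ?_ (by positivity)
      rw [Finset.sum_add_distrib, ← Finset.mul_sum, Finset.sum_comm]
      have e2 : ∀ t, ∑ x, (if bad (C t) x then (1 : ℝ) else 0) ≤ p * Fintype.card X := by
        intro t
        have := hbad (C t)
        rw [Nat.card_eq_fintype_card, Fintype.card_subtype] at this
        simpa using this
      have e3 : ∑ t, ∑ x, (if bad (C t) x then (1 : ℝ) else 0) ≤ K * (p * Fintype.card X) := by
        refine (Finset.sum_le_sum fun t _ => e2 t).trans ?_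
        simp only [Finset.sum_const, Finset.card_univ, Fintype.card_fin, nsmul_eq_mul]
        have : (N : ℝ) ≤ K := by exact_mod_cast (by omega : N ≤ K)
        gcongr
      have := mul_le_mul_of_nonneg_left e3 hz0
      simp only [Finset.sum_const, Finset.card_univ, nsmul_eq_mul, mul_one]
      linarith
    refine (Finset.sum_le_sum fun C _ => step C).trans ?_
    rw [← Finset.sum_mul]
    have : 0 ≤ z * (K * p) := by positivity
    exact mul_le_mul_of_nonneg_right (ih (by omega)) (by positivity)

/-- Markov's inequality for the exponential moment. -/
theorem card_many_earlyHits_le {X : Type*} [Fintype X] (bad : X → X → Prop)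
    (hsymm : ∀ x y, bad x y → bad y x) {p z : ℝ} (hp : 0 ≤ p) (hz : 1 ≤ z)
    (hbad : ∀ x, (Nat.card {y // bad x y} : ℝ) ≤ p * Fintype.card X) (N k : ℕ)
    (hN : N * (z * (N * p)) ≤ 1) :
    (Set.ncard {C : Fin N → X | k ≤ (earlyHits bad C).card} : ℝ) * z ^ k ≤
      3 * (Fintype.card X : ℝ) ^ N := by
  classical
  have h1 := sum_pow_card_earlyHits_le bad hsymm hp hz hbad N
  have h2 : (Set.ncard {C : Fin N → X | k ≤ (earlyHits bad C).card} : ℝ) * z ^ k ≤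
      ∑ C : Fin N → X, z ^ (earlyHits bad C).card := by
    rw [Set.ncard_eq_toFinset_card', Set.toFinset_ofPred, ← nsmul_eq_mul]
    rw [← Finset.sum_const]
    refine (Finset.sum_le_sum (g := fun C => z ^ (earlyHits bad C).card) fun C hC => ?_).trans
      (Finset.sum_le_sum_of_subset_of_nonneg (Finset.subset_univ _) fun C _ _ => by positivity)
    exact pow_le_pow_right₀ hz (by simpa using hC)
  refine h2.trans (h1.trans ?_)
  rw [mul_pow, mul_comm]
  refine mul_le_mul_of_nonneg_right ?_ (by positivity)
  calc (1 + z * (N * p)) ^ N ≤ (Real.exp (z * (N * p))) ^ N := by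
        have : 0 ≤ z * (N * p) := by positivity
        gcongr
        rw [add_comm]; exact Real.add_one_le_exp _
    _ = Real.exp (N * (z * (N * p))) := by rw [← Real.exp_nat_mul]
    _ ≤ Real.exp 1 := Real.exp_le_exp.2 hN
    _ ≤ 3 := by linarith [Real.exp_one_lt_d9]

/-- Every related pair of distinct positions, ordered increasingly, starts at an early hit, and
ends at an early hit of the reversed sequence. -/
theorem card_bad_pairs_le {X : Type*} (bad : X → X → Prop)
    (hsymm : ∀ x y, bad x y → bad y x) {N k : ℕ} (C : Fin N → X)
    (h₁ : (earlyHits bad C).card ≤ k) (h₂ : (earlyHits bad (C ∘ Fin.rev)).card ≤ k) :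
    Nat.card {q : Fin N × Fin N // q.1 ≠ q.2 ∧ bad (C q.1) (C q.2)} ≤ 2 * k ^ 2 := by
  classical
  rw [Nat.card_eq_fintype_card, Fintype.card_subtype]
  set A := earlyHits bad C
  set B := (earlyHits bad (C ∘ Fin.rev)).map Fin.revPerm.toEmbedding
  have hlt : ∀ s t, s < t → bad (C s) (C t) → s ∈ A ∧ t ∈ B := by
    intro s t hst hb
    refine ⟨by simp only [A, earlyHits, Finset.mem_filter_univ]; exact ⟨t, hst, hb⟩, ?_⟩
    simp only [B, Finset.mem_map_equiv, earlyHits, Finset.mem_filter_univ]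
    refine ⟨s.rev, ?_, ?_⟩
    · simpa using hst
    · simpa using hsymm _ _ hb
  have hsub : (Finset.univ.filter fun q : Fin N × Fin N => q.1 ≠ q.2 ∧ bad (C q.1) (C q.2)) ⊆
      A ×ˢ B ∪ B ×ˢ A := by
    rintro ⟨s, t⟩ hq
    simp only [Finset.mem_filter_univ] at hq
    simp only [Finset.mem_union, Finset.mem_product]
    rcases lt_or_gt_of_ne hq.1 with h | h
    · exact Or.inl (hlt s t h hq.2)
    · exact Or.inr (hlt t s h (hsymm _ _ hq.2)).symm
  refine (Finset.card_le_card hsub).trans ((Finset.card_union_le _ _).trans ?_)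
  have hB : B.card ≤ k := by simpa [B] using h₂
  rw [Finset.card_product, Finset.card_product]
  nlinarith [Nat.mul_le_mul h₁ hB]

/-! ### Random words against families of relations on the alphabet -/

/-- A choice, at every coordinate, of a symmetric relation on the alphabet in which every letter is
related to some letter. In the application, related letters are those that the basis of the
coordinate tells apart. -/
def IsSeparating {n : ℕ} (R : Fin n → Fin 4 → Fin 4 → Bool) : Prop :=
  (∀ i a b, R i a b = R i b a) ∧ ∀ i a, ∃ b, R i a b

/-- The coordinates at which two words are related. -/
def separated {n : ℕ} (R : Fin n → Fin 4 → Fin 4 → Bool) (c d : Fin n → Fin 4) :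
    Finset (Fin n) :=
  {i | R i (c i) (d i)}

/-- Two words are close when at most `n / 16` of the coordinates separate them. -/
def Close {n : ℕ} (R : Fin n → Fin 4 → Fin 4 → Bool) (c d : Fin n → Fin 4) : Prop :=
  (separated R c d).card ≤ n / 16

theorem Close.symm {n : ℕ} {R : Fin n → Fin 4 → Fin 4 → Bool} (hR : IsSeparating R)
    (c d : Fin n → Fin 4) (h : Close R c d) : Close R d c := by
  have : separated R d c = separated R c d := by
    ext i; simp [separated, hR.1 i (d i) (c i)]
  rwa [Close, this]

/-- A Chernoff bound: `2 ^ (-k)` has mean at most `(7 / 8) ^ n`, where `k` is the number of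
separating coordinates. -/
theorem card_close_le {n : ℕ} {R : Fin n → Fin 4 → Fin 4 → Bool} (hR : IsSeparating R)
    (c : Fin n → Fin 4) :
    (Nat.card {d // Close R c d} : ℝ) ≤
      (2 ^ (n / 16) * (7 / 8) ^ n) * Fintype.card (Fin n → Fin 4) := by
  classical
  have h1 : ∑ d : Fin n → Fin 4, ((1 : ℝ) / 2) ^ (separated R c d).card ≤ (7 / 2) ^ n := by
    have e : ∀ d : Fin n → Fin 4, ((1 : ℝ) / 2) ^ (separated R c d).card =
        ∏ i, if R i (c i) (d i) then (1 / 2 : ℝ) else 1 := by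
      intro d
      rw [Finset.prod_ite]; simp [separated]
    simp_rw [e]
    rw [← Fintype.piFinset_univ,
      ← Finset.prod_univ_sum (fun _ => Finset.univ)
        (fun i b => if R i (c i) b then (1 / 2 : ℝ) else 1)]
    have hb : ∀ i, ∑ b, (if R i (c i) b then (1 / 2 : ℝ) else 1) ≤ 7 / 2 := by
      intro i
      obtain ⟨b, hb⟩ := hR.2 i (c i)
      rw [← Finset.add_sum_erase _ _ (Finset.mem_univ b), if_pos hb]
      have : ∑ x ∈ Finset.univ.erase b, (if R i (c i) x then (1 / 2 : ℝ) else 1) ≤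
          ∑ x ∈ Finset.univ.erase b, (1 : ℝ) :=
        Finset.sum_le_sum fun x _ => by split_ifs <;> norm_num
      simp at this
      norm_num at this ⊢
      linarith
    refine (Finset.prod_le_prod (fun i _ => Finset.sum_nonneg fun b _ => ?_)
      fun i _ => hb i).trans ?_
    · split_ifs <;> norm_num
    · simp only [Finset.prod_const, Finset.card_univ, Fintype.card_fin, le_refl]
  have h2 : (Nat.card {d // Close R c d} : ℝ) * (1 / 2) ^ (n / 16) ≤
      ∑ d : Fin n → Fin 4, ((1 : ℝ) / 2) ^ (separated R c d).card := by
    rw [Nat.card_eq_fintype_card, Fintype.card_subtype, ← nsmul_eq_mul, ← Finset.sum_const]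
    refine (Finset.sum_le_sum (g := fun d => ((1 : ℝ) / 2) ^ (separated R c d).card)
      fun d hd => ?_).trans
      (Finset.sum_le_sum_of_subset_of_nonneg (Finset.subset_univ _) fun d _ _ => by positivity)
    exact pow_le_pow_of_le_one (by norm_num) (by norm_num) ((Finset.mem_filter_univ d).1 hd)
  have h3 := h2.trans h1
  rw [one_div, inv_pow, ← div_eq_mul_inv, div_le_iff₀ (by positivity)] at h3
  refine h3.trans (le_of_eq ?_)
  simp only [Fintype.card_pi, Fintype.card_fin, Finset.prod_const, Finset.card_univ]
  push_cast
  rw [mul_assoc, ← mul_pow]; norm_num; ring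

/-- A sequence of words in which, for every separating family, only boundedly many pairs are
close. The number `288` of exceptional words allowed in each direction is chosen such that, with
weight `2 ^ (n / 16)` for each of them, one more has probability of order `2 ^ (-17 n)`, enough for
a union bound over all families: `289 = 17 * 17` and `17 * (n / 16) ≥ n`. -/
def IsSparse {n N : ℕ} (C : Fin N → Fin n → Fin 4) : Prop :=
  ∀ R : Fin n → Fin 4 → Fin 4 → Bool, IsSeparating R →
    Nat.card {q : Fin N × Fin N // q.1 ≠ q.2 ∧ Close R (C q.1) (C q.2)} ≤ 2 * 288 ^ 2

/-- A random sequence of `2 ^ (n / 1024)` words is sparse: for a given separating family, failure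
has probability at most `6 * 2 ^ (-17 n)`, and there are at most `2 ^ (16 n)` families. -/
theorem card_not_isSparse_le {n : ℕ} (hn : 272 ≤ n) :
    (Set.ncard {C : Fin (2 ^ (n / 1024)) → Fin n → Fin 4 | ¬ IsSparse C} : ℝ) ≤
      1 / 5 * Nat.card (Fin (2 ^ (n / 1024)) → Fin n → Fin 4) := by
  classical
  set N := 2 ^ (n / 1024) with hN
  set j := n / 16 with hj
  set X := Fin n → Fin 4
  set p : ℝ := 2 ^ j * (7 / 8) ^ n with hp
  have hNz : (N : ℝ) * (2 ^ j * (N * p)) ≤ 1 := by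
    have h1 : (N : ℝ) * N ≤ 2 ^ j := by
      rw [hN]; push_cast
      rw [← pow_add]
      exact pow_le_pow_right₀ (by norm_num) (by omega)
    have h2 : ((7 : ℝ) / 8) ^ n ≤ (1 / 8) ^ j := by
      calc ((7 : ℝ) / 8) ^ n ≤ (7 / 8) ^ (16 * j) :=
            pow_le_pow_of_le_one (by norm_num) (by norm_num) (by omega)
        _ = ((7 / 8) ^ 16) ^ j := by rw [pow_mul]
        _ ≤ (1 / 8) ^ j := by gcongr; norm_num
    calc (N : ℝ) * (2 ^ j * (N * p)) = (N * N) * (2 ^ j * 2 ^ j) * (7 / 8) ^ n := by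
          rw [hp]; ring
      _ ≤ 2 ^ j * (2 ^ j * 2 ^ j) * (1 / 8) ^ j := by gcongr
      _ = 1 := by rw [← mul_pow, ← mul_pow, ← mul_pow]; norm_num
  have key : ∀ R : Fin n → Fin 4 → Fin 4 → Bool, IsSeparating R →
      (Set.ncard {C : Fin N → X | 289 ≤ (earlyHits (Close R) C).card} : ℝ) * 2 ^ (17 * n) ≤
        3 * (Fintype.card X : ℝ) ^ N := by
    intro R hR
    have := card_many_earlyHits_le (Close R) (Close.symm hR) (p := p) (z := 2 ^ j) (by positivity)
      (one_le_pow₀ (by norm_num)) (fun c => card_close_le hR c) N 289 hNz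
    refine le_trans ?_ this
    rw [← pow_mul]
    exact mul_le_mul_of_nonneg_left
      (pow_le_pow_right₀ (by norm_num) (by omega)) (Nat.cast_nonneg _)
  have hsub : {C : Fin N → X | ¬ IsSparse C} ⊆
      ⋃ R ∈ (Finset.univ.filter fun R : Fin n → Fin 4 → Fin 4 → Bool => IsSeparating R),
        ({C : Fin N → X | 289 ≤ (earlyHits (Close R) C).card} ∪
          (fun C => C ∘ Fin.rev) '' {C : Fin N → X | 289 ≤ (earlyHits (Close R) C).card}) := by
    intro C hC
    simp only [Set.mem_ofPred_eq, IsSparse, not_forall] at hC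
    obtain ⟨R, hR, hC⟩ := hC
    simp only [Set.mem_iUnion]
    refine ⟨R, by simpa using hR, ?_⟩
    by_contra h
    simp only [Set.mem_union, not_or] at h
    refine hC (card_bad_pairs_le _ (Close.symm hR) C ?_ ?_)
    · have := h.1
      simp only [Set.mem_ofPred_eq] at this; omega
    · have : ¬ 289 ≤ (earlyHits (Close R) (C ∘ Fin.rev)).card := fun h' =>
        h.2 ⟨C ∘ Fin.rev, h', by ext; simp⟩
      omega
  have h1 : (Set.ncard {C : Fin N → X | ¬ IsSparse C} : ℝ) * 2 ^ (17 * n) ≤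
      2 ^ (16 * n) * (6 * (Fintype.card X : ℝ) ^ N) := by
    have := (Set.ncard_le_ncard hsub (Set.toFinite _)).trans (Finset.set_ncard_biUnion_le _ _)
    have h2 : (Set.ncard {C : Fin N → X | ¬ IsSparse C} : ℝ) ≤
        ∑ R ∈ (Finset.univ.filter fun R : Fin n → Fin 4 → Fin 4 → Bool => IsSeparating R),
        (2 * Set.ncard {C : Fin N → X | 289 ≤ (earlyHits (Close R) C).card} : ℝ) := by
      refine le_trans (Nat.cast_le.2 this) ?_
      push_cast
      refine Finset.sum_le_sum fun R _ => ?_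
      have h3 := Set.ncard_union_le {C : Fin N → X | 289 ≤ (earlyHits (Close R) C).card}
        ((fun C => C ∘ Fin.rev) '' {C : Fin N → X | 289 ≤ (earlyHits (Close R) C).card})
      have h4 := Set.ncard_image_le (f := fun C : Fin N → X => C ∘ Fin.rev)
        (Set.toFinite {C : Fin N → X | 289 ≤ (earlyHits (Close R) C).card})
      have h5 := h3.trans (Nat.add_le_add_left h4 _)
      rw [two_mul]
      exact_mod_cast h5
    refine (mul_le_mul_of_nonneg_right h2 (by positivity)).trans ?_
    rw [Finset.sum_mul]
    have h3 : ∀ R ∈ (Finset.univ.filter fun R : Fin n → Fin 4 → Fin 4 → Bool => IsSeparating R),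
        (2 * Set.ncard {C : Fin N → X | 289 ≤ (earlyHits (Close R) C).card} : ℝ) * 2 ^ (17 * n) ≤
          6 * (Fintype.card X : ℝ) ^ N := by
      intro R hR
      have := key R (by simpa using hR)
      linarith
    refine (Finset.sum_le_sum h3).trans ?_
    rw [Finset.sum_const, nsmul_eq_mul]
    refine mul_le_mul_of_nonneg_right ?_ (by positivity)
    have h6 : (Finset.univ.filter fun R : Fin n → Fin 4 → Fin 4 → Bool => IsSeparating R).card ≤
        2 ^ (16 * n) := by
      refine (Finset.card_le_univ _).trans (le_of_eq ?_)
      simp only [Fintype.card_pi, Fintype.card_bool, Finset.prod_const, Finset.card_univ,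
        Fintype.card_fin]
      rw [pow_mul, ← pow_mul 2]
    exact_mod_cast h6
  rw [Nat.card_eq_fintype_card]
  have h2 : (Fintype.card (Fin N → X) : ℝ) = (Fintype.card X : ℝ) ^ N := by
    simp only [Fintype.card_pi, Finset.prod_const, Finset.card_univ, Fintype.card_fin]
    push_cast; rfl
  rw [h2]
  have h3 : (30 : ℝ) ≤ 2 ^ n :=
    le_trans (by norm_num) (pow_le_pow_right₀ (by norm_num : (1 : ℝ) ≤ 2) (by omega : 5 ≤ n))
  have h4 : (2 : ℝ) ^ (17 * n) = 2 ^ (16 * n) * 2 ^ n := by rw [← pow_add]; congr 1; ring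
  rw [h4] at h1
  have h5 : (0 : ℝ) < 2 ^ (16 * n) := by positivity
  have h6 : (Set.ncard {C : Fin N → X | ¬ IsSparse C} : ℝ) * 2 ^ n ≤
      6 * (Fintype.card X : ℝ) ^ N := by
    refine le_of_mul_le_mul_left ?_ h5
    linarith
  have h7 : (0 : ℝ) ≤ (Set.ncard {C : Fin N → X | ¬ IsSparse C} : ℝ) := by positivity
  nlinarith

/-! ### The single-qubit states -/

theorem exp_two_pi_I_div_three :
    Complex.exp (2 * Real.pi * Complex.I / 3) = ⟨-1 / 2, Real.sqrt 3 / 2⟩ := by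
  have h : (2 * Real.pi * Complex.I / 3 : ℂ) = ((2 * Real.pi / 3 : ℝ) : ℂ) * Complex.I := by
    push_cast; ring
  have e : 2 * Real.pi / 3 = Real.pi - Real.pi / 3 := by ring
  apply Complex.ext
  · rw [h, Complex.exp_ofReal_mul_I_re, e, Real.cos_pi_sub, Real.cos_pi_div_three]; norm_num
  · rw [h, Complex.exp_ofReal_mul_I_im, e, Real.sin_pi_sub, Real.sin_pi_div_three]

theorem inner_qubit (x y : EuclideanSpace ℂ (Fin 2)) :
    inner ℂ x y = star (x 0) * y 0 + star (x 1) * y 1 := by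
  simp [PiLp.inner_apply, Fin.sum_univ_two, mul_comm]

/-- The overlaps with the states `sic b`, `b ≠ 0`, in terms of a cube root of unity `⟨ξ, η⟩`. -/
theorem norm_sq_inner_of_root (x : EuclideanSpace ℂ (Fin 2)) {ξ η : ℝ} (h : ξ ^ 2 + η ^ 2 = 1) :
    ‖inner ℂ x (!₂[1 / (√3 : ℂ), (√2 : ℂ) / (√3 : ℂ) * ⟨ξ, η⟩] : EuclideanSpace ℂ (Fin 2))‖ ^ 2 =
      ((x 0).re ^ 2 + (x 0).im ^ 2 + 2 * ((x 1).re ^ 2 + (x 1).im ^ 2) +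
        2 * √2 * (ξ * ((x 0).re * (x 1).re + (x 0).im * (x 1).im) +
          η * ((x 0).re * (x 1).im - (x 0).im * (x 1).re))) / 3 := by
  have h2 : √2 ^ 2 = 2 := Real.sq_sqrt (by norm_num)
  have h3 : √3 ^ 2 = 3 := Real.sq_sqrt (by norm_num)
  have e : inner ℂ x (!₂[1 / (√3 : ℂ), (√2 : ℂ) / (√3 : ℂ) * ⟨ξ, η⟩] :
      EuclideanSpace ℂ (Fin 2)) =
      ((1 / √3 : ℝ) : ℂ) * (star (x 0) + (√2 : ℝ) * (star (x 1) * ⟨ξ, η⟩)) := by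
    rw [inner_qubit]; simp; ring
  rw [e, norm_mul, mul_pow, Complex.norm_real, Complex.sq_norm, Complex.normSq_apply]
  simp only [Real.norm_eq_abs, sq_abs, div_pow, h3, Complex.add_re, Complex.add_im,
    Complex.mul_re, Complex.mul_im, Complex.ofReal_re, Complex.ofReal_im, Complex.star_def,
    Complex.conj_re, Complex.conj_im]
  linear_combination (1 / 3 * (ξ ^ 2 + η ^ 2) * ((x 1).re ^ 2 + (x 1).im ^ 2)) * h2 +
    (2 / 3 * ((x 1).re ^ 2 + (x 1).im ^ 2)) * h

theorem sic_zero : sic 0 = !₂[1, 0] := by simp [sic]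

theorem sic_one : sic 1 = !₂[1 / (√3 : ℂ), (√2 : ℂ) / (√3 : ℂ) * ⟨1, 0⟩] := by
  have : (⟨1, 0⟩ : ℂ) = 1 := rfl
  simp [sic, this]

theorem sic_two : sic 2 = !₂[1 / (√3 : ℂ), (√2 : ℂ) / (√3 : ℂ) * ⟨-1 / 2, √3 / 2⟩] := by
  simp [sic, exp_two_pi_I_div_three]

theorem sic_three : sic 3 = !₂[1 / (√3 : ℂ), (√2 : ℂ) / (√3 : ℂ) * ⟨-1 / 2, -(√3 / 2)⟩] := by
  have h3 : √3 * √3 = 3 := Real.mul_self_sqrt (by norm_num)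
  have : (⟨-1 / 2, √3 / 2⟩ : ℂ) ^ 2 = ⟨-1 / 2, -(√3 / 2)⟩ := by
    rw [pow_two]
    apply Complex.ext
    · simp only [Complex.mul_re]; linear_combination -1 / 4 * h3
    · simp only [Complex.mul_im]; ring
  simp only [sic, exp_two_pi_I_div_three]
  rw [if_neg (by decide)]
  simp [this]

theorem norm_sq_inner_sic_zero (x : EuclideanSpace ℂ (Fin 2)) :
    ‖inner ℂ x (sic 0)‖ ^ 2 = (x 0).re ^ 2 + (x 0).im ^ 2 := by
  rw [sic_zero, inner_qubit, Complex.sq_norm, Complex.normSq_apply]; simp; ring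

/-- The four states form a complex projective 2-design, so the probabilities of an outcome have
mean `1 / 2` and variance `1 / 12`: they deviate from any given number. -/
theorem sum_sq_norm_inner_sic_sub (x : EuclideanSpace ℂ (Fin 2)) (hx : ‖x‖ = 1) (y : ℝ) :
    ∑ b, (‖inner ℂ x (sic b)‖ ^ 2 - y) ^ 2 = 4 * (y - 1 / 2) ^ 2 + 1 / 3 := by
  have h2 : √2 ^ 2 = 2 := Real.sq_sqrt (by norm_num)
  have h3 : √3 ^ 2 = 3 := Real.sq_sqrt (by norm_num)
  have hn : (x 0).re ^ 2 + (x 0).im ^ 2 + ((x 1).re ^ 2 + (x 1).im ^ 2) = 1 := by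
    have := EuclideanSpace.norm_sq_eq x
    rw [hx, Fin.sum_univ_two, Complex.sq_norm, Complex.normSq_apply, Complex.sq_norm,
      Complex.normSq_apply] at this
    linarith
  rw [Fin.sum_univ_four, norm_sq_inner_sic_zero, sic_one, sic_two, sic_three,
    norm_sq_inner_of_root x (by norm_num),
    norm_sq_inner_of_root x (by rw [div_pow, div_pow, h3]; norm_num),
    norm_sq_inner_of_root x (by rw [neg_sq, div_pow, div_pow, h3]; norm_num)]
  generalize (x 0).re = a at *
  generalize (x 0).im = b at *
  generalize (x 1).re = c at *
  generalize (x 1).im = d at *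
  have hd : c ^ 2 + d ^ 2 = 1 - (a ^ 2 + b ^ 2) := by linarith
  have hw : (a * c + b * d) ^ 2 + (a * d - b * c) ^ 2 =
      (a ^ 2 + b ^ 2) * (1 - (a ^ 2 + b ^ 2)) := by
    rw [← hd]; ring
  rw [hd]
  generalize a ^ 2 + b ^ 2 = A at *
  generalize a * c + b * d = u at *
  generalize a * d - b * c = v at *
  generalize √2 = t at *
  generalize √3 = s at *
  linear_combination (2 / 3 * u ^ 2 + 2 / 9 * s ^ 2 * v ^ 2) * h2 + (4 / 9 * v ^ 2) * h3 +
    4 / 3 * hw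

theorem norm_sic (b : Fin 4) : ‖sic b‖ = 1 := by
  have h2 : √2 ^ 2 = 2 := Real.sq_sqrt (by norm_num)
  have h3 : √3 ^ 2 = 3 := Real.sq_sqrt (by norm_num)
  have key : ∀ ξ η : ℝ, ξ ^ 2 + η ^ 2 = 1 →
      ‖(!₂[1 / (√3 : ℂ), (√2 : ℂ) / (√3 : ℂ) * ⟨ξ, η⟩] : EuclideanSpace ℂ (Fin 2))‖ = 1 := by
    intro ξ η h
    rw [← sq_eq_sq₀ (norm_nonneg _) zero_le_one, EuclideanSpace.norm_sq_eq, Fin.sum_univ_two]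
    have : ‖(⟨ξ, η⟩ : ℂ)‖ ^ 2 = 1 := by
      rw [Complex.sq_norm, Complex.normSq_apply]; simp only; linarith
    simp [div_pow, mul_pow, h2, h3, this]; norm_num
  fin_cases b
  · change ‖sic 0‖ = 1
    rw [sic_zero, ← sq_eq_sq₀ (norm_nonneg _) zero_le_one, EuclideanSpace.norm_sq_eq]; simp
  · change ‖sic 1‖ = 1
    rw [sic_one]; exact key _ _ (by norm_num)
  · change ‖sic 2‖ = 1
    rw [sic_two]; exact key _ _ (by rw [div_pow, div_pow, h3]; norm_num)
  · change ‖sic 3‖ = 1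
    rw [sic_three]; exact key _ _ (by rw [neg_sq, div_pow, div_pow, h3]; norm_num)

/-- The four states are equiangular. By the design property at `x = sic a` and `y = 1 / 3`, the term
`b = a` already accounts for the whole sum. -/
theorem norm_sq_inner_sic {a b : Fin 4} (h : a ≠ b) : ‖inner ℂ (sic a) (sic b)‖ ^ 2 = 1 / 3 := by
  have h1 := sum_sq_norm_inner_sic_sub (sic a) (norm_sic a) (1 / 3)
  rw [← Finset.add_sum_erase _ _ (Finset.mem_univ a)] at h1
  have h2 : ‖(inner ℂ (sic a) (sic a) : ℂ)‖ = 1 := by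
    rw [inner_self_eq_norm_sq_to_K, norm_sic]; simp
  rw [h2] at h1
  have h3 := Finset.single_le_sum (s := Finset.univ.erase a)
    (f := fun b => (‖(inner ℂ (sic a) (sic b) : ℂ)‖ ^ 2 - 1 / 3) ^ 2)
    (fun _ _ => sq_nonneg _) (Finset.mem_erase.2 ⟨h.symm, Finset.mem_univ b⟩)
  have h4 : (‖(inner ℂ (sic a) (sic b) : ℂ)‖ ^ 2 - 1 / 3) ^ 2 = 0 :=
    le_antisymm (by linarith) (sq_nonneg _)
  have := pow_eq_zero_iff (two_ne_zero) |>.1 h4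
  linarith

/-! ### Overlaps of outcome distributions in a single-qubit basis -/

/-- The Bhattacharyya coefficient of the outcome distributions of two of the states in a basis. -/
noncomputable def overlap (B : OrthonormalBasis (Fin 2) ℂ (EuclideanSpace ℂ (Fin 2)))
    (a b : Fin 4) : ℝ :=
  ∑ x, ‖inner ℂ (B x) (sic a)‖ * ‖inner ℂ (B x) (sic b)‖

theorem overlap_nonneg (B : OrthonormalBasis (Fin 2) ℂ (EuclideanSpace ℂ (Fin 2)))
    (a b : Fin 4) : 0 ≤ overlap B a b := Finset.sum_nonneg fun _ _ => by positivity

/-- The relation "the basis tells the letters `a` and `b` apart". -/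
noncomputable def distinguishes (B : OrthonormalBasis (Fin 2) ℂ (EuclideanSpace ℂ (Fin 2)))
    (a b : Fin 4) : Bool :=
  decide (1 / 12 ≤ (‖inner ℂ (B 0) (sic a)‖ ^ 2 - ‖inner ℂ (B 0) (sic b)‖ ^ 2) ^ 2)

theorem sum_sq_norm_inner_basis (B : OrthonormalBasis (Fin 2) ℂ (EuclideanSpace ℂ (Fin 2)))
    (a : Fin 4) : ‖inner ℂ (B 0) (sic a)‖ ^ 2 + ‖inner ℂ (B 1) (sic a)‖ ^ 2 = 1 := by
  have := B.sum_sq_norm_inner_right (sic a)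
  rwa [Fin.sum_univ_two, norm_sic, one_pow] at this

theorem overlap_le_one (B : OrthonormalBasis (Fin 2) ℂ (EuclideanSpace ℂ (Fin 2)))
    (a b : Fin 4) : overlap B a b ≤ 1 := by
  rw [overlap, Fin.sum_univ_two]
  nlinarith [sum_sq_norm_inner_basis B a, sum_sq_norm_inner_basis B b,
    sq_nonneg (‖inner ℂ (B 0) (sic a)‖ - ‖inner ℂ (B 0) (sic b)‖),
    sq_nonneg (‖inner ℂ (B 1) (sic a)‖ - ‖inner ℂ (B 1) (sic b)‖)]

/-- The Fuchs–van de Graaf inequality `overlap² ≤ 1 - distance²`. -/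
theorem overlap_le_of_distinguishes
    (B : OrthonormalBasis (Fin 2) ℂ (EuclideanSpace ℂ (Fin 2))) {a b : Fin 4}
    (h : distinguishes B a b) : overlap B a b ≤ √(11 / 12) := by
  apply Real.le_sqrt_of_sq_le
  have h := of_decide_eq_true h
  rw [overlap, Fin.sum_univ_two]
  have ha := sum_sq_norm_inner_basis B a
  have hb := sum_sq_norm_inner_basis B b
  set p := ‖inner ℂ (B 0) (sic a)‖
  set q := ‖inner ℂ (B 0) (sic b)‖
  set p' := ‖inner ℂ (B 1) (sic a)‖
  set q' := ‖inner ℂ (B 1) (sic b)‖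
  -- `(p q + p' q')² = 1 - (p q' - p' q)²`, and `p² - q² = (p q' - p' q) (p q' + p' q)`
  have e1 : (p * q + p' * q') ^ 2 + (p * q' - p' * q) ^ 2 = 1 := by
    calc _ = (p ^ 2 + p' ^ 2) * (q ^ 2 + q' ^ 2) := by ring
      _ = 1 := by rw [ha, hb, one_mul]
  have e2 : p ^ 2 - q ^ 2 = (p * q' - p' * q) * (p * q' + p' * q) := by
    linear_combination q ^ 2 * ha - p ^ 2 * hb
  have e3 : (p * q' + p' * q) ^ 2 ≤ 1 := by
    have : (p * q' + p' * q) ^ 2 + (p * q - p' * q') ^ 2 = 1 := by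
      calc _ = (p ^ 2 + p' ^ 2) * (q ^ 2 + q' ^ 2) := by ring
        _ = 1 := by rw [ha, hb, one_mul]
    nlinarith [sq_nonneg (p * q - p' * q')]
  rw [e2, mul_pow] at h
  nlinarith [sq_nonneg (p * q' - p' * q)]

theorem isSeparating_distinguishes {n : ℕ}
    (B : Fin n → OrthonormalBasis (Fin 2) ℂ (EuclideanSpace ℂ (Fin 2))) :
    IsSeparating fun i => distinguishes (B i) := by
  refine ⟨fun i a b => ?_, fun i a => ?_⟩
  · simp only [distinguishes]; congr 2; ring
  · by_contra! h
    have h1 : ∀ b,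
        (‖inner ℂ (B i 0) (sic b)‖ ^ 2 - ‖inner ℂ (B i 0) (sic a)‖ ^ 2) ^ 2 < 1 / 12 := by
      intro b
      have := h b
      rwa [distinguishes, Ne, decide_eq_true_eq, not_le, ← neg_sq, neg_sub] at this
    have h2 := sum_sq_norm_inner_sic_sub (B i 0) ((B i).orthonormal.1 0)
      (‖inner ℂ (B i 0) (sic a)‖ ^ 2)
    rw [Fin.sum_univ_four] at h2
    linarith [h1 0, h1 1, h1 2, h1 3, sq_nonneg (‖inner ℂ (B i 0) (sic a)‖ ^ 2 - 1 / 2)]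

/-! ### Measurement bases with adaptive qubits -/

theorem inner_prod_eq_prod_inner {ι : Type*} [Fintype ι] [DecidableEq ι]
    (f g : ι → EuclideanSpace ℂ (Fin 2)) :
    inner ℂ (WithLp.toLp 2 (fun w => ∏ i, f i (w i)) : Qubits ι)
      (WithLp.toLp 2 fun w => ∏ i, g i (w i)) = ∏ i, inner ℂ (f i) (g i) := by
  simp only [PiLp.inner_apply, RCLike.inner_apply, map_prod, ← Finset.prod_mul_distrib]
  rw [Finset.prod_univ_sum, Fintype.piFinset_univ]

/-- A sum over bit strings, split into the parts inside and outside `S`. -/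
theorem sum_split {n : ℕ} (S : Finset (Fin n)) {α : Type*} [AddCommMonoid α]
    (f : ({i // i ∉ S} → Fin 2) → ({i // i ∈ S} → Fin 2) → α) :
    ∑ w : Fin n → Fin 2, f (fun i => w i) (fun i => w i) = ∑ z, ∑ y, f z y := by
  rw [Finset.sum_comm, ← Fintype.sum_prod_type']
  exact (Equiv.piEquivPiSubtypeProd (· ∈ S) fun _ => Fin 2).sum_comp fun q => f q.2 q.1

theorem inner_split {n : ℕ} (S : Finset (Fin n)) (f g : {i // i ∉ S} → EuclideanSpace ℂ (Fin 2))
    (u v : Qubits {i // i ∈ S}) (φ ψ : Qubits (Fin n))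
    (hφ : ∀ w, φ w = (∏ i, f i (w i)) * u fun i => w i)
    (hψ : ∀ w, ψ w = (∏ i, g i (w i)) * v fun i => w i) :
    inner ℂ φ ψ = (∏ i, inner ℂ (f i) (g i)) * inner ℂ u v := by
  rw [← inner_prod_eq_prod_inner]
  simp only [PiLp.inner_apply, RCLike.inner_apply]
  rw [Finset.sum_mul_sum, ← sum_split]
  refine Finset.sum_congr rfl fun w _ => ?_
  rw [hφ, hψ, map_mul]
  ring

/-- The product state of a word over an arbitrary index type. -/
noncomputable def productState {ι : Type*} [Fintype ι] (c : ι → Fin 4) : Qubits ι :=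
  WithLp.toLp 2 fun w => ∏ i, sic (c i) (w i)

theorem norm_productState {ι : Type*} [Fintype ι] [DecidableEq ι] (c : ι → Fin 4) :
    ‖productState c‖ = 1 := by
  have h : inner ℂ (productState c) (productState c) = (1 : ℂ) := by
    rw [productState, inner_prod_eq_prod_inner]
    refine Finset.prod_eq_one fun i _ => ?_
    rw [inner_self_eq_norm_sq_to_K, norm_sic]; simp
  rw [inner_self_eq_norm_sq_to_K] at h
  rw [← sq_eq_sq₀ (norm_nonneg _) zero_le_one, one_pow]
  refine Complex.ofReal_injective ?_
  push_cast
  exact h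

theorem norm_sicProduct {n : ℕ} (c : Fin n → Fin 4) : ‖sicProduct c‖ = 1 := norm_productState c

theorem norm_sq_inner_sicProduct {n : ℕ} (c d : Fin n → Fin 4) :
    ‖inner ℂ (sicProduct c) (sicProduct d)‖ ^ 2 =
      (1 / 3) ^ (separated (fun _ a b => decide (a ≠ b)) c d).card := by
  rw [sicProduct, sicProduct, inner_prod_eq_prod_inner, norm_prod, ← Finset.prod_pow]
  have : ∀ i, ‖inner ℂ (sic (c i)) (sic (d i))‖ ^ 2 = if c i ≠ d i then (1 / 3 : ℝ) else 1 := by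
    intro i
    split_ifs with h
    · exact norm_sq_inner_sic h
    · rw [not_not.1 h, inner_self_eq_norm_sq_to_K, norm_sic]; simp
  simp_rw [this]
  rw [Finset.prod_ite]
  simp [separated]

namespace AdaptiveBasis

variable {n ℓ : ℕ} (M : AdaptiveBasis n ℓ)

theorem inner_vec_sicProduct (x : Fin n → Fin 2) (c : Fin n → Fin 4) :
    inner ℂ (M.vec x) (sicProduct c) =
      (∏ i : {i // i ∉ M.S}, inner ℂ (M.fixedPart i (x i)) (sic (c i))) *
        inner ℂ (M.adaptivePart (fun i => x i) fun i => x i)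
          (productState fun i : {i // i ∈ M.S} => c i) := by
  refine inner_split M.S _ _ _ _ _ _ (fun w => rfl) fun w => ?_
  simp only [sicProduct, productState]
  rw [mul_comm]
  convert! (Fintype.prod_subtype_mul_prod_subtype (· ∈ M.S) fun i => sic (c i) (w i)).symm

theorem orthonormal_vec : Orthonormal ℂ M.vec := by
  classical
  rw [orthonormal_iff_ite]
  intro x y
  rw [inner_split M.S _ _ _ _ (M.vec x) (M.vec y) (fun w => rfl) fun w => rfl]
  by_cases h : (fun i : {i // i ∉ M.S} => x i) = fun i : {i // i ∉ M.S} => y i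
  · rw [← h, OrthonormalBasis.inner_eq_ite]
    have h1 : ∏ i : {i // i ∉ M.S}, inner ℂ (M.fixedPart i (x i)) (M.fixedPart i (y i)) =
        (1 : ℂ) := by
      refine Finset.prod_eq_one fun i _ => ?_
      rw [← congrFun h i, OrthonormalBasis.inner_eq_one]
    rw [h1, one_mul]
    refine if_congr ⟨fun h2 => ?_, fun h2 => by rw [h2]⟩ rfl rfl
    ext i
    by_cases hi : i ∈ M.S
    · exact congrArg Fin.val (congrFun h2 ⟨i, hi⟩)
    · exact congrArg Fin.val (congrFun h ⟨i, hi⟩)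
  · obtain ⟨i, hi⟩ := Function.ne_iff.1 h
    rw [if_neg fun h' => h (by rw [h']), Finset.prod_eq_zero (Finset.mem_univ i), zero_mul]
    exact (M.fixedPart i).inner_eq_zero hi

theorem sum_sq_norm_inner_vec (ψ : Qubits (Fin n)) :
    ∑ x, ‖inner ℂ (M.vec x) ψ‖ ^ 2 = ‖ψ‖ ^ 2 := by
  have hcard : Fintype.card (Fin n → Fin 2) = Module.finrank ℂ (Qubits (Fin n)) := by simp
  have hB := M.orthonormal_vec
  rw [← coe_basisOfOrthonormalOfCardEqFinrank hB hcard] at hB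
  have := ((basisOfOrthonormalOfCardEqFinrank M.orthonormal_vec hcard).toOrthonormalBasis
    hB).sum_sq_norm_inner_right ψ
  simpa using this

/-- The adaptive qubits contribute at most `1`, by the Cauchy–Schwarz inequality, whatever outcome
on the other qubits their basis depends on. -/
theorem sum_norm_inner_mul_le_prod_overlap (c d : Fin n → Fin 4) :
    ∑ x, ‖inner ℂ (M.vec x) (sicProduct c)‖ * ‖inner ℂ (M.vec x) (sicProduct d)‖ ≤
      ∏ i : {i // i ∉ M.S}, overlap (M.fixedPart i) (c i) (d i) := by
  simp only [inner_vec_sicProduct, overlap]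
  rw [Finset.prod_univ_sum, Fintype.piFinset_univ,
    sum_split M.S fun z y =>
    ‖(∏ i, inner ℂ (M.fixedPart i (z i)) (sic (c i))) *
        inner ℂ (M.adaptivePart z y) (productState fun i : {i // i ∈ M.S} => c i)‖ *
    ‖(∏ i, inner ℂ (M.fixedPart i (z i)) (sic (d i))) *
        inner ℂ (M.adaptivePart z y) (productState fun i : {i // i ∈ M.S} => d i)‖]
  refine Finset.sum_le_sum fun z _ => ?_
  have hu : ∀ e : {i // i ∈ M.S} → Fin 4,
      ∑ y, ‖inner ℂ (M.adaptivePart z y) (productState e)‖ ^ 2 = (1 : ℝ) := by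
    intro e
    rw [OrthonormalBasis.sum_sq_norm_inner_right, norm_productState, one_pow]
  have hcs : ∑ y, ‖inner ℂ (M.adaptivePart z y) (productState fun i : {i // i ∈ M.S} => c i)‖ *
      ‖inner ℂ (M.adaptivePart z y) (productState fun i : {i // i ∈ M.S} => d i)‖ ≤ 1 := by
    refine (Real.sum_mul_le_sqrt_mul_sqrt _ _ _).trans ?_
    rw [hu, hu]; simp
  calc _ = (∏ i, ‖inner ℂ (M.fixedPart i (z i)) (sic (c i))‖ *
        ‖inner ℂ (M.fixedPart i (z i)) (sic (d i))‖) *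
        ∑ y, ‖inner ℂ (M.adaptivePart z y) (productState fun i : {i // i ∈ M.S} => c i)‖ *
      ‖inner ℂ (M.adaptivePart z y) (productState fun i : {i // i ∈ M.S} => d i)‖ := by
        rw [Finset.mul_sum]
        refine Finset.sum_congr rfl fun y _ => ?_
        rw [norm_mul, norm_mul, norm_prod, norm_prod, Finset.prod_mul_distrib]
        ring
    _ ≤ _ := mul_le_of_le_one_right (Finset.prod_nonneg fun i _ => by positivity) hcs

/-- The separating relations of the single-qubit bases; on adaptive qubits, where there is none,
the computational basis serves as a filler. -/
noncomputable def separation (i : Fin n) : Fin 4 → Fin 4 → Bool :=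
  distinguishes (if h : i ∉ M.S then M.fixedPart ⟨i, h⟩ else EuclideanSpace.basisFun (Fin 2) ℂ)

theorem isSeparating_separation : IsSeparating M.separation :=
  isSeparating_distinguishes fun i =>
    if h : i ∉ M.S then M.fixedPart ⟨i, h⟩ else EuclideanSpace.basisFun (Fin 2) ℂ

theorem sum_norm_inner_mul_le_pow (c d : Fin n → Fin 4) :
    ∑ x, ‖inner ℂ (M.vec x) (sicProduct c)‖ * ‖inner ℂ (M.vec x) (sicProduct d)‖ ≤
      √(11 / 12) ^ ((separated M.separation c d).card - ℓ) := by
  have hr : √(11 / 12) ≤ 1 := Real.sqrt_le_one.2 (by norm_num)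
  refine (M.sum_norm_inner_mul_le_prod_overlap c d).trans ?_
  have h1 : ∀ i : {i // i ∉ M.S}, overlap (M.fixedPart i) (c i) (d i) ≤
      if M.separation i (c i) (d i) then √(11 / 12) else 1 := by
    intro i
    split_ifs with h
    · rw [separation, dif_pos i.2] at h
      exact overlap_le_of_distinguishes _ h
    · exact overlap_le_one _ _ _
  refine (Finset.prod_le_prod (fun i _ => overlap_nonneg _ _ _) fun i _ => h1 i).trans ?_
  rw [Finset.prod_ite, Finset.prod_const, Finset.prod_const_one, mul_one]
  refine pow_le_pow_of_le_one (Real.sqrt_nonneg _) hr ?_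
  have h2 : separated M.separation c d ⊆ M.S ∪ (Finset.univ.filter fun i : {i // i ∉ M.S} =>
      M.separation i (c i) (d i)).map (Function.Embedding.subtype _) := by
    intro i hi
    by_cases h : i ∈ M.S
    · exact Finset.mem_union_left _ h
    · refine Finset.mem_union_right _ (Finset.mem_map.2 ⟨⟨i, h⟩, ?_, rfl⟩)
      simpa [separated] using hi
  have h3 := (Finset.card_le_card h2).trans (Finset.card_union_le _ _)
  rw [Finset.card_map] at h3
  have := M.card_le
  omega

theorem sum_norm_inner_mul_le_one (c d : Fin n → Fin 4) :
    ∑ x, ‖inner ℂ (M.vec x) (sicProduct c)‖ * ‖inner ℂ (M.vec x) (sicProduct d)‖ ≤ 1 :=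
  (M.sum_norm_inner_mul_le_pow c d).trans
    (pow_le_one₀ (Real.sqrt_nonneg _) (Real.sqrt_le_one.2 (by norm_num)))

end AdaptiveBasis

/-! ### Outcome probabilities of the two states -/

open scoped ComplexOrder

theorem fidelity_proj {n : ℕ} (φ ψ : Qubits (Fin n)) :
    fidelity φ (proj ψ) = ‖inner ℂ φ ψ‖ ^ 2 := by
  have h : inner ℂ φ ψ = star (φ : (Fin n → Fin 2) → ℂ) ⬝ᵥ (ψ : (Fin n → Fin 2) → ℂ) := by
    rw [EuclideanSpace.inner_eq_star_dotProduct, dotProduct_comm]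
  have h' : star (inner ℂ φ ψ) = star (ψ : (Fin n → Fin 2) → ℂ) ⬝ᵥ (φ : (Fin n → Fin 2) → ℂ) := by
    rw [Complex.star_def, inner_conj_symm, EuclideanSpace.inner_eq_star_dotProduct, dotProduct_comm]
  rw [fidelity, proj, Matrix.vecMulVec_mulVec, ← h', dotProduct_smul, ← h,
    MulOpposite.smul_eq_mul_unop, MulOpposite.unop_op, Complex.star_def, Complex.mul_conj,
    Complex.ofReal_re,
    Complex.normSq_eq_norm_sq]

theorem fidelity_mixedState {n N : ℕ} (φ : Qubits (Fin n)) (C : Fin N → Fin n → Fin 4) :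
    fidelity φ (mixedState C) = 1 / N * ∑ t, ‖inner ℂ φ (sicProduct (C t))‖ ^ 2 := by
  simp only [← fidelity_proj, fidelity, mixedState]
  rw [Matrix.smul_mulVec, dotProduct_smul, Matrix.sum_mulVec, dotProduct_sum, smul_eq_mul,
    ← Complex.ofReal_natCast, ← Complex.ofReal_one, ← Complex.ofReal_div, Complex.re_ofReal_mul,
    Complex.re_sum]

theorem posSemidef_proj {n : ℕ} (ψ : Qubits (Fin n)) : (proj ψ).PosSemidef :=
  Matrix.posSemidef_vecMulVec_self_star _

theorem trace_proj {n : ℕ} {ψ : Qubits (Fin n)} (h : ‖ψ‖ = 1) : (proj ψ).trace = 1 := by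
  rw [proj, Matrix.trace_vecMulVec, ← EuclideanSpace.inner_eq_star_dotProduct,
    inner_self_eq_norm_sq_to_K, h]
  simp

theorem isDensity_proj {n : ℕ} {ψ : Qubits (Fin n)} (h : ‖ψ‖ = 1) : IsDensity (proj ψ) :=
  ⟨posSemidef_proj ψ, trace_proj h⟩

theorem isDensity_mixedState {n N : ℕ} (hN : 0 < N) (C : Fin N → Fin n → Fin 4) :
    IsDensity (mixedState C) := by
  refine ⟨(Matrix.posSemidef_sum _ fun t _ => posSemidef_proj _).smul ?_, ?_⟩
  · rw [← Complex.ofReal_natCast, ← Complex.ofReal_one, ← Complex.ofReal_div]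
    exact Complex.zero_le_real.2 (by positivity)
  · rw [mixedState, Matrix.trace_smul, Matrix.trace_sum]
    simp only [trace_proj (norm_sicProduct _)]
    have : (N : ℂ) ≠ 0 := by exact_mod_cast hN.ne'
    simp [this]

/-- All amplitudes at the zero bit string are positive, so the superposition never vanishes. -/
theorem superposition_ne_zero {n N : ℕ} (hN : 0 < N) (C : Fin N → Fin n → Fin 4) :
    superposition C ≠ 0 := by
  intro h
  have hs : ∀ b, ∃ r : ℝ, 0 < r ∧ sic b 0 = r := by
    intro b
    by_cases hb : b = 0
    · exact ⟨1, one_pos, by simp [hb, sic]⟩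
    · exact ⟨1 / √3, by positivity, by simp [hb, sic]⟩
  choose r hr hr' using hs
  have h0 := congrArg (fun v : Qubits (Fin n) => v 0) h
  simp only [superposition, PiLp.smul_apply, WithLp.ofLp_sum, Finset.sum_apply, sicProduct,
    Pi.zero_apply, hr', PiLp.zero_apply, smul_eq_mul, mul_eq_zero] at h0
  have : Nonempty (Fin N) := ⟨⟨0, hN⟩⟩
  rcases h0 with h0 | h0
  · have : (√N : ℂ) ≠ 0 := by
      exact_mod_cast (Real.sqrt_pos.2 (by exact_mod_cast hN : (0 : ℝ) < N)).ne'
    simp [this] at h0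
  · have h1 : ∑ t, ∏ i, r (C t i) = 0 := by exact_mod_cast h0
    have : 0 < ∑ t, ∏ i, r (C t i) :=
      Finset.sum_pos (fun t _ => Finset.prod_pos fun i _ => hr _) Finset.univ_nonempty
    linarith

theorem norm_pureState {n N : ℕ} (hN : 0 < N) (C : Fin N → Fin n → Fin 4) :
    ‖pureState C‖ = 1 := by
  have h : ‖superposition C‖ ≠ 0 := norm_ne_zero_iff.2 (superposition_ne_zero hN C)
  rw [pureState, norm_smul, Complex.norm_real, norm_inv, norm_norm, inv_mul_cancel₀ h]

/-! ### Strategies -/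

/-- The measurement of all qubits in the computational basis. -/
noncomputable def AdaptiveBasis.computational {n ℓ : ℕ} : AdaptiveBasis n ℓ where
  S := ∅
  card_le := by simp
  fixedPart _ := EuclideanSpace.basisFun _ _
  adaptivePart _ := EuclideanSpace.basisFun _ _

/-- Every measurement of the state `σ` yields a probability distribution. -/
def HasOutcomeLaws {n : ℕ} (ℓ : ℕ) (σ : Op n) : Prop :=
  ∀ M : AdaptiveBasis n ℓ, (∀ x, 0 ≤ fidelity (M.vec x) σ) ∧ ∑ x, fidelity (M.vec x) σ = 1

theorem hasOutcomeLaws_proj {n ℓ : ℕ} {ψ : Qubits (Fin n)} (h : ‖ψ‖ = 1) :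
    HasOutcomeLaws ℓ (proj ψ) := by
  intro M
  simp only [fidelity_proj]
  exact ⟨fun x => by positivity, by rw [M.sum_sq_norm_inner_vec, h, one_pow]⟩

theorem hasOutcomeLaws_mixedState {n N ℓ : ℕ} (hN : 0 < N) (C : Fin N → Fin n → Fin 4) :
    HasOutcomeLaws ℓ (mixedState C) := by
  intro M
  simp only [fidelity_mixedState]
  refine ⟨fun x => by positivity, ?_⟩
  rw [← Finset.mul_sum, Finset.sum_comm]
  simp only [M.sum_sq_norm_inner_vec, norm_sicProduct]
  have : (N : ℝ) ≠ 0 := by exact_mod_cast hN.ne'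
  simp [this]

namespace Strategy

variable {n ℓ : ℕ} {σ τ : Op n}

theorem acceptProb_mem_Icc (hσ : HasOutcomeLaws ℓ σ) {T : ℕ} (s : Strategy n ℓ T) :
    s.acceptProb σ ∈ Set.Icc (0 : ℝ) 1 := by
  induction s with
  | output v => cases v <;> simp [acceptProb]
  | measure M next ih =>
    obtain ⟨h0, h1⟩ := hσ M
    rw [acceptProb]
    refine ⟨Finset.sum_nonneg fun x _ => mul_nonneg (h0 x) (ih x).1, ?_⟩
    rw [← h1]
    exact Finset.sum_le_sum fun x _ => mul_le_of_le_one_right (h0 x) (ih x).2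

/-- The hybrid argument: every copy contributes at most the largest `L¹` distance of the outcome
distributions. -/
theorem acceptProb_sub_le (hσ : HasOutcomeLaws ℓ σ) (hτ : HasOutcomeLaws ℓ τ) {D : ℝ}
    (hD : ∀ M : AdaptiveBasis n ℓ, ∑ x, |fidelity (M.vec x) σ - fidelity (M.vec x) τ| ≤ D)
    {T : ℕ} (s : Strategy n ℓ T) : s.acceptProb σ - s.acceptProb τ ≤ T * D := by
  induction s with
  | @output T v =>
    have : 0 ≤ D := (Finset.sum_nonneg fun _ _ => abs_nonneg _).trans
      (hD .computational)
    simp only [acceptProb, sub_self]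
    positivity
  | @measure T M next ih =>
    obtain ⟨h0, h1⟩ := hτ M
    simp only [acceptProb]
    calc _ = ∑ x, (fidelity (M.vec x) σ - fidelity (M.vec x) τ) * (next x).acceptProb σ +
          ∑ x, fidelity (M.vec x) τ * ((next x).acceptProb σ - (next x).acceptProb τ) := by
          rw [← Finset.sum_sub_distrib, ← Finset.sum_add_distrib]
          exact Finset.sum_congr rfl fun x _ => by ring
      _ ≤ ∑ x, |fidelity (M.vec x) σ - fidelity (M.vec x) τ| +
          ∑ x, fidelity (M.vec x) τ * (T * D) := by
          refine add_le_add (Finset.sum_le_sum fun x _ => ?_) (Finset.sum_le_sum fun x _ =>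
            mul_le_mul_of_nonneg_left (ih x) (h0 x))
          obtain ⟨ha, hb⟩ := acceptProb_mem_Icc hσ (next x)
          exact (mul_le_mul_of_nonneg_right (le_abs_self _) ha).trans
            (mul_le_of_le_one_right (abs_nonneg _) hb)
      _ ≤ D + T * D := by
          rw [← Finset.sum_mul, h1, one_mul]
          exact add_le_add_left (hD M) _
      _ = ((T + 1 : ℕ) : ℝ) * D := by push_cast; ring

/-- If `τ` gives every outcome at least `κ` times its probability under `σ`, no strategy
distinguishes the two perfectly. -/
theorem pow_mul_acceptProb_le (hσ : HasOutcomeLaws ℓ σ) (hτ : HasOutcomeLaws ℓ τ) {κ : ℝ}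
    (h0 : 0 ≤ κ)
    (hκ : ∀ (M : AdaptiveBasis n ℓ) x, κ * fidelity (M.vec x) σ ≤ fidelity (M.vec x) τ)
    {T : ℕ} (s : Strategy n ℓ T) : κ ^ T * s.acceptProb σ ≤ s.acceptProb τ := by
  have h1 : κ ≤ 1 := by
    have := Finset.sum_le_sum fun x (_ : x ∈ Finset.univ) => hκ .computational x
    rwa [← Finset.mul_sum, (hσ _).2, (hτ _).2, mul_one] at this
  induction s with
  | output v => cases v <;> simp [acceptProb, pow_le_one₀ h0 h1]
  | @measure T M next ih =>
    simp only [acceptProb]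
    rw [Finset.mul_sum]
    refine Finset.sum_le_sum fun x _ => ?_
    calc _ = (κ * fidelity (M.vec x) σ) * (κ ^ T * (next x).acceptProb σ) := by
          rw [pow_succ]; ring
      _ ≤ fidelity (M.vec x) τ * (next x).acceptProb τ := by
          refine mul_le_mul (hκ M x) (ih x) ?_ ((hτ M).1 x)
          exact mul_nonneg (by positivity) (acceptProb_mem_Icc hσ _).1

end Strategy

theorem Algorithm.successProb_le {n ℓ T : ℕ} (A : Algorithm n ℓ T) {σ τ : Op n}
    (hσ : IsDensity σ) (hτ : IsDensity τ) (hσ' : HasOutcomeLaws ℓ σ) (hτ' : HasOutcomeLaws ℓ τ)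
    {b : ℝ} (h : ∀ s : Strategy n ℓ T, s.acceptProb σ - s.acceptProb τ ≤ b) :
    A.successProb σ τ ≤ 1 / 2 + b / 2 := by
  let := A.measurableSpace
  have := A.isProbabilityMeasure
  have hint : ∀ ρ, IsDensity ρ → HasOutcomeLaws ℓ ρ →
      MeasureTheory.Integrable (fun r => (A.strategy r).acceptProb ρ) A.law := by
    intro ρ h1 h2
    refine MeasureTheory.Integrable.of_mem_Icc 0 1 (A.measurable_acceptProb ρ h1).aemeasurable ?_
    exact Filter.Eventually.of_forall fun r => Strategy.acceptProb_mem_Icc h2 _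
  have hle : A.acceptProb σ - A.acceptProb τ ≤ b := by
    unfold Algorithm.acceptProb
    rw [← MeasureTheory.integral_sub (hint σ hσ hσ') (hint τ hτ hτ')]
    refine (MeasureTheory.integral_mono ((hint σ hσ hσ').sub (hint τ hτ hτ'))
      (MeasureTheory.integrable_const b) fun r => h _).trans ?_
    simp
  unfold Algorithm.successProb
  linarith

/-! ### Interference -/

theorem abs_norm_sq_sum_sub_le {N : ℕ} (a : Fin N → ℂ) :
    |‖∑ t, a t‖ ^ 2 - ∑ t, ‖a t‖ ^ 2| ≤
      ∑ q : Fin N × Fin N with q.1 ≠ q.2, ‖a q.1‖ * ‖a q.2‖ := by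
  have h1 : ((‖∑ t, a t‖ ^ 2 - ∑ t, ‖a t‖ ^ 2 : ℝ) : ℂ) =
      ∑ q : Fin N × Fin N with q.1 ≠ q.2, a q.1 * star (a q.2) := by
    have h2 : ((‖∑ t, a t‖ ^ 2 : ℝ) : ℂ) = ∑ q : Fin N × Fin N, a q.1 * star (a q.2) := by
      rw [← Complex.normSq_eq_norm_sq, ← Complex.mul_conj, map_sum, Finset.sum_mul_sum,
        Fintype.sum_prod_type]
      rfl
    have h3 : ((∑ t, ‖a t‖ ^ 2 : ℝ) : ℂ) =
        ∑ q : Fin N × Fin N with ¬ q.1 ≠ q.2, a q.1 * star (a q.2) := by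
      rw [Finset.sum_filter, Fintype.sum_prod_type]
      simp [Complex.mul_conj, Complex.normSq_eq_norm_sq]
    rw [Complex.ofReal_sub, h2, h3, ← Finset.sum_filter_add_sum_filter_not Finset.univ
      (fun q : Fin N × Fin N => q.1 ≠ q.2), add_sub_cancel_right]
  rw [← Real.norm_eq_abs, ← Complex.norm_real, h1]
  refine (norm_sum_le _ _).trans (le_of_eq ?_)
  simp

/-- The total overlap of the outcome distributions of distinct product states, which bounds the
interference terms of the superposition. -/
noncomputable def crossOverlap {n N ℓ : ℕ} (M : AdaptiveBasis n ℓ) (C : Fin N → Fin n → Fin 4) :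
    ℝ :=
  ∑ q : Fin N × Fin N with q.1 ≠ q.2,
    ∑ x, ‖inner ℂ (M.vec x) (sicProduct (C q.1))‖ * ‖inner ℂ (M.vec x) (sicProduct (C q.2))‖

theorem norm_sq_inner_superposition {n N : ℕ} (φ : Qubits (Fin n)) (C : Fin N → Fin n → Fin 4) :
    ‖inner ℂ φ (superposition C)‖ ^ 2 = 1 / N * ‖∑ t, inner ℂ φ (sicProduct (C t))‖ ^ 2 := by
  rw [superposition, inner_smul_right, inner_sum, norm_mul, mul_pow, ← Complex.ofReal_one,
    ← Complex.ofReal_div, Complex.norm_real, Real.norm_eq_abs, sq_abs, div_pow, one_pow,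
    Real.sq_sqrt (Nat.cast_nonneg N)]

theorem norm_sq_inner_pureState {n N : ℕ} (φ : Qubits (Fin n)) (C : Fin N → Fin n → Fin 4) :
    ‖inner ℂ φ (superposition C)‖ ^ 2 =
      ‖superposition C‖ ^ 2 * ‖inner ℂ φ (pureState C)‖ ^ 2 := by
  by_cases h : ‖superposition C‖ = 0
  · rw [norm_eq_zero.1 h]; simp
  · rw [pureState, inner_smul_right, norm_mul, mul_pow, Complex.norm_real, norm_inv, norm_norm,
      inv_pow, mul_inv_cancel_left₀ (pow_ne_zero 2 h)]

/-- The outcome distributions of the two states differ by the interference terms, and by the error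
in normalizing the superposition, which is no larger. -/
theorem sum_abs_fidelity_sub_le {n N ℓ : ℕ} (hN : 0 < N) (C : Fin N → Fin n → Fin 4)
    (M : AdaptiveBasis n ℓ) :
    ∑ x, |fidelity (M.vec x) (proj (pureState C)) - fidelity (M.vec x) (mixedState C)| ≤
      2 * (crossOverlap M C / N) := by
  have hN0 : (0 : ℝ) < N := by exact_mod_cast hN
  obtain ⟨-, hτ⟩ := hasOutcomeLaws_mixedState (ℓ := ℓ) hN C M
  obtain ⟨hσ0, hσ⟩ := hasOutcomeLaws_proj (ℓ := ℓ) (norm_pureState hN C) M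
  set V := ‖superposition C‖ ^ 2 with hV
  have h1 : ∑ x, |V * fidelity (M.vec x) (proj (pureState C)) -
      fidelity (M.vec x) (mixedState C)| ≤ crossOverlap M C / N := by
    rw [crossOverlap, Finset.sum_comm, Finset.sum_div]
    refine Finset.sum_le_sum fun x _ => ?_
    rw [fidelity_proj, ← norm_sq_inner_pureState, norm_sq_inner_superposition, fidelity_mixedState,
      ← mul_sub, abs_mul, abs_of_pos (by positivity : (0 : ℝ) < 1 / N), one_div_mul_eq_div]
    gcongr
    exact abs_norm_sq_sum_sub_le _
  have h2 : |V - 1| ≤ crossOverlap M C / N := by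
    refine le_trans ?_ h1
    have : V - 1 = ∑ x, (V * fidelity (M.vec x) (proj (pureState C)) -
        fidelity (M.vec x) (mixedState C)) := by
      rw [Finset.sum_sub_distrib, ← Finset.mul_sum, hσ, hτ, mul_one]
    rw [this]
    exact Finset.abs_sum_le_sum_abs _ _
  have h3 : ∑ x, |1 - V| * fidelity (M.vec x) (proj (pureState C)) = |1 - V| := by
    rw [← Finset.mul_sum, hσ, mul_one]
  calc _ ≤ ∑ x, (|1 - V| * fidelity (M.vec x) (proj (pureState C)) +
        |V * fidelity (M.vec x) (proj (pureState C)) - fidelity (M.vec x) (mixedState C)|) := by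
        refine Finset.sum_le_sum fun x _ => ?_
        rw [← abs_of_nonneg (hσ0 x), ← abs_mul, abs_of_nonneg (hσ0 x)]
        refine le_trans (le_of_eq ?_) (abs_add_le _ _)
        congr 1; ring
    _ ≤ 2 * (crossOverlap M C / N) := by
        rw [Finset.sum_add_distrib, h3, abs_sub_comm]
        linarith

/-- The superposition of `N` vectors is dominated by `N` times their mixture. -/
theorem mul_fidelity_pureState_le {n N : ℕ} (hN : 0 < N) (C : Fin N → Fin n → Fin 4)
    (φ : Qubits (Fin n)) :
    ‖superposition C‖ ^ 2 / N * fidelity φ (proj (pureState C)) ≤ fidelity φ (mixedState C) := by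
  have hN0 : (0 : ℝ) < N := by exact_mod_cast hN
  have h : ‖∑ t, inner ℂ φ (sicProduct (C t))‖ ^ 2 ≤
      N * ∑ t, ‖inner ℂ φ (sicProduct (C t))‖ ^ 2 := by
    refine (pow_le_pow_left₀ (norm_nonneg _) (norm_sum_le _ _) 2).trans ?_
    simpa using sq_sum_le_card_mul_sum_sq (s := Finset.univ)
      (f := fun t => ‖inner ℂ φ (sicProduct (C t))‖)
  rw [fidelity_proj, div_mul_eq_mul_div, ← norm_sq_inner_pureState, norm_sq_inner_superposition,
    fidelity_mixedState, one_div_mul_eq_div, one_div_mul_eq_div]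
  gcongr
  rwa [div_le_iff₀ hN0, mul_comm]

/-- The fidelity of a unit vector with a mixture is at most the Frobenius norm of the Gram
matrix. -/
theorem sq_fidelity_mixedState_le {n N : ℕ} {ψ : Qubits (Fin n)} (hψ : ‖ψ‖ = 1)
    (C : Fin N → Fin n → Fin 4) :
    fidelity ψ (mixedState C) ^ 2 ≤
      (∑ q : Fin N × Fin N, ‖inner ℂ (sicProduct (C q.1)) (sicProduct (C q.2))‖ ^ 2) / N ^ 2 := by
  set β : Fin N → ℂ := fun t => inner ℂ (sicProduct (C t)) ψ with hβ
  set Q : ℝ := ∑ t, ‖β t‖ ^ 2 with hQ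
  set G : ℝ := ∑ q : Fin N × Fin N, ‖inner ℂ (sicProduct (C q.1)) (sicProduct (C q.2))‖ ^ 2
  have hQ0 : 0 ≤ Q := Finset.sum_nonneg fun _ _ => by positivity
  have hF : fidelity ψ (mixedState C) = Q / N := by
    rw [fidelity_mixedState, one_div_mul_eq_div]
    congr 1
    exact Finset.sum_congr rfl fun t _ => by rw [hβ, norm_inner_symm]
  set y : Qubits (Fin n) := ∑ t, β t • sicProduct (C t) with hy
  have h1 : Q ≤ ‖y‖ := by
    have : inner ℂ ψ y = (Q : ℂ) := by
      rw [hy, inner_sum, hQ, Complex.ofReal_sum]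
      refine Finset.sum_congr rfl fun t _ => ?_
      rw [inner_smul_right, ← inner_conj_symm, Complex.mul_conj, Complex.normSq_eq_norm_sq]
    calc Q = ‖inner ℂ ψ y‖ := by rw [this, Complex.norm_real, Real.norm_of_nonneg hQ0]
      _ ≤ ‖ψ‖ * ‖y‖ := norm_inner_le_norm _ _
      _ = ‖y‖ := by rw [hψ, one_mul]
  have h2 : ‖y‖ ^ 2 ≤ Q * √G := by
    have e : ((‖y‖ ^ 2 : ℝ) : ℂ) = ∑ q : Fin N × Fin N,
        star (β q.1) * β q.2 * inner ℂ (sicProduct (C q.1)) (sicProduct (C q.2)) := by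
      rw [Fintype.sum_prod_type, Complex.ofReal_pow]
      refine (inner_self_eq_norm_sq_to_K (𝕜 := ℂ) y).symm.trans ?_
      rw [hy, sum_inner]
      refine Finset.sum_congr rfl fun s _ => ?_
      rw [inner_sum]
      refine Finset.sum_congr rfl fun t _ => ?_
      rw [inner_smul_left, inner_smul_right, mul_assoc]; rfl
    calc ‖y‖ ^ 2 = ‖((‖y‖ ^ 2 : ℝ) : ℂ)‖ := by
          rw [Complex.norm_real, Real.norm_of_nonneg (by positivity)]
      _ ≤ ∑ q : Fin N × Fin N, (‖β q.1‖ * ‖β q.2‖) *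
          ‖inner ℂ (sicProduct (C q.1)) (sicProduct (C q.2))‖ := by
          rw [e]
          refine (norm_sum_le _ _).trans (le_of_eq ?_)
          simp only [norm_mul, norm_star]
      _ ≤ √(∑ q : Fin N × Fin N, (‖β q.1‖ * ‖β q.2‖) ^ 2) * √G :=
          Real.sum_mul_le_sqrt_mul_sqrt _ _ _
      _ = Q * √G := by
          congr 1
          rw [Fintype.sum_prod_type]
          simp only [mul_pow]
          rw [← Finset.sum_mul_sum, Real.sqrt_mul_self hQ0]
  have h3 : Q ≤ √G := by
    rcases hQ0.eq_or_lt with h | h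
    · rw [← h]; positivity
    · refine le_of_mul_le_mul_left (le_trans ?_ h2) h
      rw [← pow_two]; gcongr
  have hG : 0 ≤ G := Finset.sum_nonneg fun _ _ => by positivity
  rw [hF, div_pow]
  gcongr
  calc Q ^ 2 ≤ √G ^ 2 := by gcongr
    _ = G := Real.sq_sqrt hG

/-! ### Sparse sequences -/

/-- In a sparse sequence, a pair function bounded by `1` and small on pairs that are not close has a
small sum; `165888 = 2 * 288 ^ 2` bounds the number of close pairs. -/
theorem sum_offDiag_le {n N : ℕ} {C : Fin N → Fin n → Fin 4} (hC : IsSparse C)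
    {R : Fin n → Fin 4 → Fin 4 → Bool} (hR : IsSeparating R) {f : Fin N × Fin N → ℝ} {ε : ℝ}
    (hf : ∀ q, f q ≤ 1) (hε : 0 ≤ ε)
    (hfε : ∀ q, ¬ Close R (C q.1) (C q.2) → f q ≤ ε) :
    ∑ q : Fin N × Fin N with q.1 ≠ q.2, f q ≤ 165888 + N ^ 2 * ε := by
  classical
  have h := hC R hR
  rw [Nat.card_eq_fintype_card, Fintype.card_subtype] at h
  calc ∑ q : Fin N × Fin N with q.1 ≠ q.2, f q
      ≤ ∑ q : Fin N × Fin N with q.1 ≠ q.2,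
          ((if Close R (C q.1) (C q.2) then 1 else 0) + ε) := by
        refine Finset.sum_le_sum fun q _ => ?_
        split_ifs with hq
        · linarith [hf q]
        · linarith [hfε q hq]
    _ ≤ 165888 + N ^ 2 * ε := by
        rw [Finset.sum_add_distrib]
        refine add_le_add ?_ ?_
        · rw [← Finset.sum_filter, Finset.filter_filter, Finset.sum_const, nsmul_eq_mul, mul_one]
          exact_mod_cast h
        · rw [Finset.sum_const, nsmul_eq_mul]
          have : (Finset.univ.filter fun q : Fin N × Fin N => q.1 ≠ q.2).card ≤ N ^ 2 := by
            refine (Finset.card_le_univ _).trans (le_of_eq ?_)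
            simp [pow_two]
          gcongr
          exact_mod_cast this

theorem crossOverlap_le {n N ℓ m : ℕ} {C : Fin N → Fin n → Fin 4} (hC : IsSparse C)
    (hm : 1024 * m ≤ n) (hℓ : 64 * ℓ ≤ n) (M : AdaptiveBasis n ℓ) :
    crossOverlap M C ≤ 165888 + N ^ 2 * (1 / 2) ^ (3 * m) := by
  refine sum_offDiag_le hC M.isSeparating_separation
    (fun q => M.sum_norm_inner_mul_le_one _ _) (by positivity) fun q hq => ?_
  refine (M.sum_norm_inner_mul_le_pow _ _).trans ?_
  have hq : n / 16 < (separated M.separation (C q.1) (C q.2)).card := not_le.1 hq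
  -- `(11 / 12) ^ 8 ≤ 1 / 2`, and at least `n / 16 - n / 64 ≥ 48 m` separating coordinates are not
  -- adaptive
  calc √(11 / 12) ^ ((separated M.separation (C q.1) (C q.2)).card - ℓ)
      ≤ √(11 / 12) ^ (2 * (8 * (3 * m))) :=
        pow_le_pow_of_le_one (Real.sqrt_nonneg _) (Real.sqrt_le_one.2 (by norm_num)) (by omega)
    _ = ((11 / 12) ^ 8) ^ (3 * m) := by
        rw [pow_mul, Real.sq_sqrt (by norm_num), pow_mul]
    _ ≤ (1 / 2) ^ (3 * m) := by gcongr; norm_num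

theorem isSeparating_ne {n : ℕ} :
    IsSeparating fun (_ : Fin n) (a b : Fin 4) => decide (a ≠ b) := by
  refine ⟨fun _ a b => by simp [ne_comm], fun _ a => ⟨a + 1, ?_⟩⟩
  have : ∀ a : Fin 4, decide (a ≠ a + 1) = true := by decide
  exact this a

theorem sq_fidelity_le_of_isSparse {n N m : ℕ} {C : Fin N → Fin n → Fin 4} (hC : IsSparse C)
    (hm : 16 * m ≤ n) {ψ : Qubits (Fin n)} (hψ : ‖ψ‖ = 1) :
    fidelity ψ (mixedState C) ^ 2 ≤ (N + (165888 + N ^ 2 * (1 / 2) ^ m)) / N ^ 2 := by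
  refine (sq_fidelity_mixedState_le hψ C).trans ?_
  gcongr
  rw [← Finset.sum_filter_not_add_sum_filter _ (fun q : Fin N × Fin N => q.1 ≠ q.2)]
  refine add_le_add ?_ (sum_offDiag_le hC isSeparating_ne (fun q => ?_) (by positivity)
    fun q hq => ?_)
  · rw [Finset.sum_filter, Fintype.sum_prod_type]
    simp [norm_sicProduct]
  · rw [norm_sq_inner_sicProduct]
    exact pow_le_one₀ (by norm_num) (by norm_num)
  · have hq := not_le.1 hq
    rw [norm_sq_inner_sicProduct]
    refine (pow_le_pow_of_le_one (by norm_num) (by norm_num) (by omega : m ≤ _)).trans ?_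
    gcongr; norm_num

/-! ### Counting good sequences -/

theorem card_le_ncard_of_ncard_not_le {α : Type*} [Finite α] {P Q : α → Prop}
    (hPQ : ∀ C, Q C → P C) (h : (Set.ncard {C | ¬ Q C} : ℝ) ≤ 1 / 5 * Nat.card α) :
    (4 / 5 : ℝ) * Nat.card α ≤ Set.ncard {C | P C} := by
  have h1 : ((Set.ncard {C | Q C} : ℕ) : ℝ) + Set.ncard {C | ¬ Q C} = Nat.card α := by
    exact_mod_cast Set.ncard_add_ncard_compl {C | Q C}
  have h2 : (Set.ncard {C | Q C} : ℝ) ≤ Set.ncard {C | P C} := by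
    exact_mod_cast Set.ncard_le_ncard hPQ
  linarith

theorem card_constant_le {n : ℕ} (hn : 1 ≤ n) :
    (Set.ncard {C : Fin 4 → Fin n → Fin 4 | ¬ ∃ t, C t ≠ C 0} : ℝ) ≤
      1 / 5 * Nat.card (Fin 4 → Fin n → Fin 4) := by
  have hsub : {C : Fin 4 → Fin n → Fin 4 | ¬ ∃ t, C t ≠ C 0} ⊆
      Set.range (Function.const (Fin 4)) := by
    intro C hC
    refine ⟨C 0, ?_⟩
    ext1 t
    by_contra h
    exact hC ⟨t, fun h' => h h'.symm⟩
  have h1 : Set.ncard {C : Fin 4 → Fin n → Fin 4 | ¬ ∃ t, C t ≠ C 0} ≤ 4 ^ n := by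
    refine (Set.ncard_le_ncard hsub (Set.toFinite _)).trans ?_
    rw [← Set.image_univ]
    refine (Set.ncard_image_le (Set.toFinite _)).trans ?_
    simp [Set.ncard_univ]
  have h2 : (Set.ncard {C : Fin 4 → Fin n → Fin 4 | ¬ ∃ t, C t ≠ C 0} : ℝ) ≤ 4 ^ n := by
    exact_mod_cast h1
  have h3 : (4 : ℝ) ≤ 4 ^ n := by simpa using pow_le_pow_right₀ (by norm_num : (1 : ℝ) ≤ 4) hn
  have h4 : (Nat.card (Fin 4 → Fin n → Fin 4) : ℝ) = ((4 : ℝ) ^ n) ^ 4 := by simp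
  rw [h4]
  refine h2.trans ?_
  generalize (4 : ℝ) ^ n = y at *
  nlinarith [mul_le_mul h3 h3 (by norm_num) (by linarith : 0 ≤ y),
    pow_le_pow_left₀ (by norm_num) h3 3]

theorem le_two_rpow_of_sq_le {F e : ℝ} (h : F ^ 2 ≤ 2 ^ (-(2 * e))) : F ≤ (2 : ℝ) ^ (-e) := by
  refine le_of_sq_le_sq ?_ (by positivity)
  rwa [← Real.rpow_natCast (2 ^ (-e)) 2, ← Real.rpow_mul (by norm_num),
    show -e * ((2 : ℕ) : ℝ) = -(2 * e) by push_cast; ring]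

/-- Four words that are not all equal give states that are neither parallel nor perfectly
distinguishable. -/
theorem fidelity_le_of_not_constant {n : ℕ} {C : Fin 4 → Fin n → Fin 4} (hC : ∃ t, C t ≠ C 0)
    (hn : n < 65536) :
    fidelity (pureState C) (mixedState C) ≤ (2 : ℝ) ^ (-(1 / 4194304 * (n : ℝ))) := by
  obtain ⟨t, ht⟩ := hC
  have hF := sq_fidelity_mixedState_le (norm_pureState (by norm_num) C) C
  have hG : ∑ q : Fin 4 × Fin 4, ‖inner ℂ (sicProduct (C q.1)) (sicProduct (C q.2))‖ ^ 2 ≤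
      46 / 3 := by
    rw [← Finset.add_sum_erase _ _ (Finset.mem_univ (t, (0 : Fin 4)))]
    have h1 : ‖inner ℂ (sicProduct (C t)) (sicProduct (C 0))‖ ^ 2 ≤ 1 / 3 := by
      rw [norm_sq_inner_sicProduct]
      obtain ⟨i, hi⟩ := Function.ne_iff.1 ht
      refine pow_le_of_le_one (by norm_num) (by norm_num) (Finset.card_ne_zero_of_mem (a := i) ?_)
      simpa [separated] using hi
    have h2 : ∑ q ∈ Finset.univ.erase (t, (0 : Fin 4)),
        ‖inner ℂ (sicProduct (C q.1)) (sicProduct (C q.2))‖ ^ 2 ≤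
        ∑ q ∈ Finset.univ.erase (t, (0 : Fin 4)), (1 : ℝ) := by
      refine Finset.sum_le_sum fun q _ => ?_
      rw [norm_sq_inner_sicProduct]
      exact pow_le_one₀ (by norm_num) (by norm_num)
    rw [Finset.sum_const, Finset.card_erase_of_mem (Finset.mem_univ _)] at h2
    simp only [Finset.card_univ, Fintype.card_prod, Fintype.card_fin, nsmul_eq_mul, mul_one] at h2
    norm_num only at h2
    dsimp only
    linarith
  refine le_two_rpow_of_sq_le (hF.trans ?_)
  have h3 : (2 : ℝ) ^ (-(1 / 32 : ℝ)) ≤ 2 ^ (-(2 * (1 / 4194304 * (n : ℝ)))) := by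
    refine Real.rpow_le_rpow_of_exponent_le (by norm_num) ?_
    have : (n : ℝ) ≤ 65536 := by exact_mod_cast hn.le
    linarith
  refine le_trans ?_ h3
  -- the off-diagonal entry that is at most `1 / 3` leaves `46 / 3 = 16 * (23 / 24)`
  have h4 : (23 / 24 : ℝ) ≤ 2 ^ (-(1 / 32 : ℝ)) := by
    refine le_of_pow_le_pow_left₀ (n := 32) (by norm_num) (by positivity) ?_
    rw [← Real.rpow_natCast (2 ^ _), ← Real.rpow_mul (by norm_num)]
    norm_num
  refine le_trans ?_ h4
  rw [div_le_iff₀ (by norm_num)]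
  norm_num
  linarith

/-- No algorithm succeeds with certainty, as the mixture contains a multiple of the pure state. -/
theorem successProb_lt_one {n N ℓ T : ℕ} (hN : 0 < N) (C : Fin N → Fin n → Fin 4)
    (A : Algorithm n ℓ T) : A.successProb (proj (pureState C)) (mixedState C) < 1 := by
  have hN0 : (0 : ℝ) < N := by exact_mod_cast hN
  set κ : ℝ := ‖superposition C‖ ^ 2 / N with hκ
  have hκ0 : 0 < κ := by
    have := norm_pos_iff.2 (superposition_ne_zero hN C)
    positivity
  have hσ := hasOutcomeLaws_proj (ℓ := ℓ) (norm_pureState hN C)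
  have hτ := hasOutcomeLaws_mixedState (ℓ := ℓ) hN C
  have h := A.successProb_le (isDensity_proj (norm_pureState hN C)) (isDensity_mixedState hN C)
    hσ hτ (b := 1 - min 1 (κ ^ T)) fun s => by
      have h1 := s.pow_mul_acceptProb_le hσ hτ hκ0.le
        fun M x => mul_fidelity_pureState_le hN C (M.vec x)
      obtain ⟨h2, h3⟩ := s.acceptProb_mem_Icc hσ
      have h4 : min 1 (κ ^ T) * s.acceptProb (proj (pureState C)) ≤
          κ ^ T * s.acceptProb (proj (pureState C)) :=
        mul_le_mul_of_nonneg_right (min_le_right _ _) h2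
      nlinarith [min_le_left 1 (κ ^ T)]
  have : 0 < min 1 (κ ^ T) := lt_min one_pos (by positivity)
  linarith

theorem successProb_le_of_isSparse {n ℓ T m : ℕ} {C : Fin (2 ^ m) → Fin n → Fin 4}
    (hC : IsSparse C) (hm : 1024 * m ≤ n) (hℓ : 64 * ℓ ≤ n) (A : Algorithm n ℓ T) :
    A.successProb (proj (pureState C)) (mixedState C) ≤ 1 / 2 + T * (2 ^ 18 * (1 / 2) ^ m) := by
  have hN : 0 < 2 ^ m := by positivity
  have hD : ∀ M : AdaptiveBasis n ℓ, ∑ x, |fidelity (M.vec x) (proj (pureState C)) -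
      fidelity (M.vec x) (mixedState C)| ≤ 2 * (2 ^ 18 * (1 / 2) ^ m) := by
    intro M
    refine (sum_abs_fidelity_sub_le hN C M).trans ?_
    refine mul_le_mul_of_nonneg_left ?_ zero_le_two
    have h := crossOverlap_le hC hm hℓ M
    have h1 : ((2 : ℝ) ^ m) * (1 / 2) ^ m = 1 := by rw [← mul_pow]; norm_num
    have h2 : ((1 : ℝ) / 2) ^ m ≤ 1 := pow_le_one₀ (by norm_num) (by norm_num)
    push_cast at h ⊢
    rw [div_le_iff₀ (by positivity)]
    have e1 : ((2 : ℝ) ^ m) ^ 2 * (1 / 2) ^ (3 * m) = (1 / 2) ^ m := by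
      calc _ = (2 ^ m * (1 / 2) ^ m) ^ 2 * ((1 : ℝ) / 2) ^ m := by rw [mul_comm 3 m, pow_mul]; ring
        _ = _ := by rw [h1]; ring
    have e2 : (2 : ℝ) ^ 18 * (1 / 2) ^ m * 2 ^ m = 2 ^ 18 := by
      rw [mul_assoc, mul_comm _ ((2 : ℝ) ^ m), h1, mul_one]
    rw [e2]
    rw [e1] at h
    norm_num at h2 ⊢
    norm_num at h
    linarith
  refine (A.successProb_le (isDensity_proj (norm_pureState hN C)) (isDensity_mixedState hN C)
    (hasOutcomeLaws_proj (norm_pureState hN C)) (hasOutcomeLaws_mixedState hN C)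
    fun s => s.acceptProb_sub_le (hasOutcomeLaws_proj (norm_pureState hN C))
      (hasOutcomeLaws_mixedState hN C) hD).trans (le_of_eq ?_)
  ring

theorem fidelity_le_of_isSparse {n m : ℕ} {C : Fin (2 ^ m) → Fin n → Fin 4} (hC : IsSparse C)
    (hm64 : 64 ≤ m) (hm : 1024 * m ≤ n) (hm' : n ≤ 1024 * (m + 1)) :
    fidelity (pureState C) (mixedState C) ≤ (2 : ℝ) ^ (-(1 / 4194304 * (n : ℝ))) := by
  have hN : 0 < 2 ^ m := by positivity
  have hF := sq_fidelity_le_of_isSparse hC (by omega : 16 * m ≤ n) (norm_pureState hN C)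
  refine le_two_rpow_of_sq_le (hF.trans ?_)
  have h1 : ((2 : ℝ) ^ m) * (1 / 2) ^ m = 1 := by rw [← mul_pow]; norm_num
  have h2 : (165888 : ℝ) ≤ 2 ^ m :=
    le_trans (by norm_num) (pow_le_pow_right₀ (by norm_num : (1 : ℝ) ≤ 2) (by omega : 18 ≤ m))
  calc _ ≤ 4 * ((1 : ℝ) / 2) ^ m := by
        push_cast
        rw [div_le_iff₀ (by positivity)]
        have e1 : 4 * ((1 : ℝ) / 2) ^ m * (2 ^ m) ^ 2 = 4 * 2 ^ m := by
          linear_combination (4 * (2 : ℝ) ^ m) * h1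
        have e2 : ((2 : ℝ) ^ m) ^ 2 * (1 / 2) ^ m = 2 ^ m := by
          linear_combination ((2 : ℝ) ^ m) * h1
        rw [e1, e2]
        linarith
    _ = (2 : ℝ) ^ (2 - (m : ℝ)) := by
        rw [Real.rpow_sub (by norm_num), Real.rpow_natCast, div_pow, one_pow, mul_one_div]
        norm_num
    _ ≤ _ := by
        refine Real.rpow_le_rpow_of_exponent_le (by norm_num) ?_
        have h3 : (n : ℝ) ≤ 1024 * (m + 1) := by exact_mod_cast hm'
        have h4 : (64 : ℝ) ≤ m := by exact_mod_cast hm64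
        linarith

end QCert

theorem mainTheorem3 :
    ∃ c₁ c₂ c₃ c₄ a b : ℝ, 0 < c₁ ∧ 0 < c₂ ∧ 0 < c₃ ∧ 0 < c₄ ∧ 0 < a ∧ 0 < b ∧
      ∀ n : ℕ, 1 ≤ n → ∃ N : ℕ, (2 : ℝ) ^ (a * n) ≤ N ∧ (N : ℝ) ≤ (2 : ℝ) ^ (b * n) ∧
        (4 / 5 : ℝ) * (Nat.card (Fin N → Fin n → Fin 4) : ℝ) ≤
          (Set.ncard {C : Fin N → Fin n → Fin 4 |
            ‖QCert.pureState C‖ = 1 ∧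
            QCert.IsDensity (QCert.mixedState C) ∧
            QCert.fidelity (QCert.pureState C) (QCert.mixedState C) ≤ (2 : ℝ) ^ (-(c₁ * n)) ∧
            ∀ (ℓ T : ℕ) (A : QCert.Algorithm n ℓ T), (ℓ : ℝ) ≤ c₂ * n →
              1 / 2 + (2 : ℝ) ^ (-(c₃ * n)) ≤
                A.successProb (QCert.proj (QCert.pureState C)) (QCert.mixedState C) →
              (2 : ℝ) ^ (c₄ * n) ≤ T} : ℝ) := by
  refine ⟨1 / 4194304, 1 / 64, 1 / 65536, 1 / 65536, 1 / 65536, 2, by norm_num, by norm_num,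
    by norm_num, by norm_num, by norm_num, by norm_num, fun n hn => ?_⟩
  have hn1 : (1 : ℝ) ≤ n := by exact_mod_cast hn
  rcases lt_or_ge n 65536 with hsmall | hlarge
  · have hn2 : (n : ℝ) ≤ 65536 := by exact_mod_cast hsmall.le
    refine ⟨4, ?_, ?_, QCert.card_le_ncard_of_ncard_not_le (Q := fun C => ∃ t, C t ≠ C 0)
      (fun C hC => ⟨QCert.norm_pureState (by norm_num) C,
        QCert.isDensity_mixedState (by norm_num) C, QCert.fidelity_le_of_not_constant hC hsmall,
        fun ℓ T A _ hA => ?_⟩) (QCert.card_constant_le hn)⟩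
    · calc (2 : ℝ) ^ (1 / 65536 * (n : ℝ)) ≤ 2 ^ (1 : ℝ) :=
            Real.rpow_le_rpow_of_exponent_le (by norm_num) (by linarith)
        _ ≤ (4 : ℕ) := by norm_num
    · calc ((4 : ℕ) : ℝ) = 2 ^ (2 : ℝ) := by norm_num
        _ ≤ (2 : ℝ) ^ (2 * (n : ℝ)) :=
            Real.rpow_le_rpow_of_exponent_le (by norm_num) (by linarith)
    · -- the required success probability is at least `1` here, so no algorithm attains it
      have h1 : (2 : ℝ) ^ (-1 : ℝ) ≤ 2 ^ (-(1 / 65536 * (n : ℝ))) :=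
        Real.rpow_le_rpow_of_exponent_le (by norm_num) (by linarith)
      rw [Real.rpow_neg_one] at h1
      have h2 := QCert.successProb_lt_one (by norm_num) C A
      exfalso
      linarith
  · set m := n / 1024 with hm
    have hm64 : (64 : ℝ) ≤ m := by exact_mod_cast (by omega : 64 ≤ m)
    have hnm : (n : ℝ) ≤ 1024 * (m + 1) := by exact_mod_cast (by omega : n ≤ 1024 * (m + 1))
    have hmn : (m : ℝ) ≤ n := by exact_mod_cast (by omega : m ≤ n)
    have hpow : ((2 ^ m : ℕ) : ℝ) = (2 : ℝ) ^ (m : ℝ) := by rw [Real.rpow_natCast]; push_cast; rfl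
    refine ⟨2 ^ m, ?_, ?_, QCert.card_le_ncard_of_ncard_not_le (Q := QCert.IsSparse)
      (fun C hC => ⟨QCert.norm_pureState (by positivity) C,
        QCert.isDensity_mixedState (by positivity) C,
        QCert.fidelity_le_of_isSparse hC (by omega) (by omega) (by omega),
        fun ℓ T A hℓ hA => ?_⟩) (QCert.card_not_isSparse_le (by omega))⟩
    · rw [hpow]
      exact Real.rpow_le_rpow_of_exponent_le (by norm_num) (by linarith)
    · rw [hpow]
      exact Real.rpow_le_rpow_of_exponent_le (by norm_num) (by linarith)
    · have hℓ' : 64 * ℓ ≤ n := by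
        have : (64 : ℝ) * ℓ ≤ n := by linarith
        exact_mod_cast this
      have h := hA.trans (QCert.successProb_le_of_isSparse hC (by omega) hℓ' A)
      have h1 : (2 : ℝ) ^ (-(1 / 65536 * (n : ℝ))) ≤ T * (2 ^ 18 * (1 / 2) ^ m) := by linarith
      have h2 : (2 : ℝ) ^ 18 * (1 / 2) ^ m = 2 ^ (18 - (m : ℝ)) := by
        rw [Real.rpow_sub (by norm_num), Real.rpow_natCast, div_pow, one_pow, mul_one_div]
        norm_num
      rw [h2, ← div_le_iff₀ (by positivity), ← Real.rpow_sub (by norm_num)] at h1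
      refine le_trans ?_ h1
      exact Real.rpow_le_rpow_of_exponent_le (by norm_num) (by linarith)
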